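/- For $c=\pm1$, an integer $q\ge 1$ (with $q\ne 1$ when $c=1$) and $\alpha>0$ let $$\Phi(c,q,\alpha)=\sum_{m=0}^\infty\frac{c^m}{(m+\alpha)^q},$$ and for $q=0$ let $\Phi(c,0,\alpha)$ denote the value given by analytic continuation in $q$, so that $\Phi(1,0,1)=\zeta(0)=-\tfrac12$ and $\Phi(-1,0,1)=\tfrac12$. For $0<s<r$ put $$\Theta(c,q,s,r)=\Phi\left(c,q,\tfrac sr\right)+c(-1)^q\,\Phi\left(c,q,\tfrac{r-s}r\right)\quad\text{if }(c,q)\neq(1,1),\qquad \Theta(1,1,s,r)=\pi\cot\left(\tfrac{\pi s}r\right).$$ For a positive integer $p$ and real $x$ let $$\operatorname{Li}_p(x)=\frac{(-1)^{p-1}}{(p-1)!}\int_0^1\frac{x\ln^{p-1}(y)}{1-xy}\,\mathrm dy,$$ where for $x>1$ the integral is a Cauchy principal value at $y=1/x$. **Theorem.** Let $p,q,n$ be positive integers and $a,b\in\{1,-1\}$, with $p\ne1$ when $a^nb=1$ and $q\neq1$ when $a=1$. Then the following integral converges absolutely (for $b=1$ with the principal-value meaning of $\operatorname{Li}_p(x^n)$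 for $x>1$), and $$\int_0^\infty\frac{\ln^{q-1}(x)\operatorname{Li}_{p}(bx^{n})}{x(1-ax)}\,\mathrm dx=-a^{n-1}b\,(1+(-1)^{q})\,(q-1)!\,\Phi(a^nb,p,1)\,\Phi(a,q,1)$$ $$+\,2a^n n^{-q}(q-1)!\sum_{j=0}^{\lfloor q/2\rfloor}\binom{p+q-2j-1}{p-1}\Phi(b,2j,1)\,\Phi(a^nb,p+q-2j,1)$$ $$+\,a^{n-1}b\,n^{-q}(q-1)!\sum_{j=2}^{n}\sum_{k=1}^{q}\binom{p+q-k-1}{p-1}a^{j}(-1)^{k}\,\Theta(b,k,j-1,n)\,\Phi\left(a^nb,p+q-k,\tfrac{n-j+1}{n}\right).$$ -/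

import Mathlib

open Filter Topology MeasureTheory Set

noncomputable section

/-- The Cauchy principal value of `∫ y in S, f y` with respect to a singularity at `c`: the limit
of the integrals over `S` with a symmetric `ε`-neighbourhood of `c` removed, as `ε → 0⁺`. -/
def cauchyPV (f : ℝ → ℝ) (S : Set ℝ) (c : ℝ) : ℝ :=
  limUnder (𝓝[>] (0 : ℝ)) (fun ε : ℝ => ∫ y in {y | y ∈ S ∧ ε < |y - c|}, f y)

/-- The (real) polylogarithm
`Li_p(x) = (-1)^(p-1) / (p-1)! * ∫₀¹ x * log(y)^(p-1) / (1 - x*y) dy` of order `p ≥ 1`.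
For `x > 1` the integrand has a simple pole at `y = 1/x ∈ (0,1)`, and the integral is
a Cauchy principal value there. -/
def polyLi (p : ℕ) (x : ℝ) : ℝ :=
  (-1) ^ (p - 1) / ((p - 1).factorial : ℝ) *
    (if x ≤ 1 then ∫ y in Ioo (0 : ℝ) 1, x * Real.log y ^ (p - 1) / (1 - x * y)
     else cauchyPV (fun y => x * Real.log y ^ (p - 1) / (1 - x * y)) (Ioo 0 1) x⁻¹)

/-- The Lerch transcendent `Φ(c, q, α) = ∑_{m ≥ 0} c^m / (m + α)^q`, for `c = ±1` and a natural
number `q`. For `q ≥ 1` this is the limit of the partial sums (the series converges only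
conditionally for `c = -1`, `q = 1`). For `q = 0` it is the value at `s = 0` of the analytic
continuation of `s ↦ Φ(c, s, α)`, that is `ζ(0, α) = 1/2 - α` for `c = 1` and `1 / (1 - c)`
otherwise; in particular `Φ(1, 0, 1) = ζ(0) = -1/2` and `Φ(-1, 0, 1) = η(0) = 1/2`. -/
def lerchPhi (c : ℝ) (q : ℕ) (α : ℝ) : ℝ :=
  if q = 0 then
    (if c = 1 then 1 / 2 - α else 1 / (1 - c))
  else ∑'[SummationFilter.conditional ℕ] m : ℕ, c ^ m / ((m : ℝ) + α) ^ q

/-- `Θ(c, q, s, r) = Φ(c, q, s/r) + c * (-1)^q * Φ(c, q, (r-s)/r)`. For `c = q = 1` both series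
diverge and `Θ(1, 1, s, r) = π * cot(π * s / r)`, which is the principal value of
`∫₀^∞ r * x^(s-1) / (1 - x^r) dx`. -/
def lerchTheta (c : ℝ) (q : ℕ) (s r : ℝ) : ℝ :=
  if c = 1 ∧ q = 1 then Real.pi * Real.cot (Real.pi * s / r)
  else lerchPhi c q (s / r) + c * (-1) ^ q * lerchPhi c q ((r - s) / r)

end

/-!
Write `x = e^s`, `y = e^{-nt}`. With `K(w) = b e^{nw} / (1 - b e^{nw})` and
`h(s) = s^(q-1) / (1 - a e^s)`, the definition of the polylogarithm becomes the convolution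
`Li_p(b e^{ns}) = n^p / (p-1)! * PV ∫_{t > 0} t^(p-1) K(s - t) dt`, so that the integral to be
computed is `n^p / (p-1)! * ∫ h(s) (PV ∫_{t > 0} t^(p-1) K(s - t) dt) ds`. The idea is to integrate
over `s` first: the inner integral `PV ∫ h(t + w) K(w) dw` is elementary by partial fractions.

The kernel satisfies `K(-v) = g(v)` and `K(v) = -1 - g(v)` for `v > 0`, where `g` is
`polyLiKernel b n`. All principal values at `w = 0` are therefore encoded by adding the values of an
integrand at `v` and `-v` and integrating over `v > 0`, and both cases `b = 1` and `b = -1` are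
treated by the same formulas.
* `polyLi_mul_exp_pow` is the convolution formula in this symmetrized form. For `b = 1`, `s > 0` it
  compares the window that is symmetric in `y` with the one that is symmetric in `w`.
* `integral_mul_symm_convolution` exchanges the integrations. The symmetrized integrands are
  absolutely integrable on the product space, because truncated powers are Hölder continuous of
  exponent `1/2` off the origin and `h` extends to a locally Lipschitz function (`exists_weight`);
  this also gives the absolute convergence of the integral over `s`.
* `integral_symm_kernel_mul_weight` evaluates the inner integral. Partial fractions in `e^s` split
  it into terms that are, up to the factor `e^{-nt} / (1 - a^n b e^{-nt})` and exponentials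
  `e^{it}`, polynomials in `t`. Their coefficients are moments of `e^{-cv} / (1 - b e^{-nv})`, that
  is values of the Lerch transcendent (`integral_pow_mul_lerchKernel`), or of the
  cotangent where the individual moments diverge (`integral_lerchKernel_sub`). A shift of the cut from `0` to `t` produces the term
  `t^q / q`, which is the summand `Φ(b, 0, 1)` of the formula.
* The outer integral over `t` is again a sum of Lerch moments (`integral_pow_mul_inner`).
-/

/-! ### Laplace integrals of the Lerch kernel -/

lemma integrableOn_pow_mul_exp_neg (k : ℕ) {c : ℝ} (hc : 0 < c) :
    IntegrableOn (fun v : ℝ => v ^ k * Real.exp (-(c * v))) (Ioi 0) := by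
  have h := integrableOn_rpow_mul_exp_neg_mul_rpow (p := 1) (s := k) (b := c)
    (by have : (0 : ℝ) ≤ k := k.cast_nonneg
        linarith) one_pos hc
  refine h.congr_fun (fun v _ => ?_) measurableSet_Ioi
  simp [Real.rpow_natCast]

lemma integral_pow_mul_exp_neg (k : ℕ) {c : ℝ} (hc : 0 < c) :
    ∫ v in Ioi (0 : ℝ), v ^ k * Real.exp (-(c * v)) = k.factorial / c ^ (k + 1) := by
  have h := Real.integral_rpow_mul_exp_neg_mul_Ioi (a := k + 1) (by positivity) hc
  rw [Real.Gamma_nat_eq_factorial] at h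
  simp only [add_sub_cancel_right, Real.rpow_natCast] at h
  rw [h]
  have : ((1 / c) ^ ((k : ℝ) + 1)) = (1 / c) ^ (k + 1) := by
    exact_mod_cast Real.rpow_natCast _ (k + 1)
  rw [this, one_div, inv_pow]; ring

lemma one_sub_mul_exp_neg_pos {β : ℝ} (hβ : β = 1 ∨ β = -1) {x : ℝ} (hx : 0 < x) :
    0 < 1 - β * Real.exp (-x) := by
  have h1 : Real.exp (-x) < 1 := by simpa using hx
  have h2 := Real.exp_pos (-x)
  rcases hβ with rfl | rfl <;> linarith

lemma inv_one_sub_mul_exp_neg_le {β : ℝ} (hβ : β = 1 ∨ β = -1) {x : ℝ} (hx : 0 < x) :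
    1 / (1 - β * Real.exp (-x)) ≤ 1 + x⁻¹ := by
  rw [div_le_iff₀ (one_sub_mul_exp_neg_pos hβ hx)]
  have h2 := Real.exp_pos (-x)
  have h3 : Real.exp (-x) * (1 + x) ≤ 1 := by
    have := Real.add_one_le_exp x
    calc Real.exp (-x) * (1 + x) ≤ Real.exp (-x) * Real.exp x := by gcongr; linarith
      _ = 1 := by rw [← Real.exp_add]; simp
  have h4 : (1 + x⁻¹) = (1 + x) / x := by field_simp; ring
  rw [h4, div_mul_eq_mul_div, le_div_iff₀ hx]
  rcases hβ with rfl | rfl <;> nlinarith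

/-- The kernel `e^{-cv} / (1 - β e^{-rv}) = ∑ β^m e^{-(c + rm)v}` whose moments are the values
of the Lerch transcendent. -/
noncomputable def lerchKernel (β r c v : ℝ) : ℝ :=
  Real.exp (-(c * v)) / (1 - β * Real.exp (-(r * v)))

@[fun_prop]
lemma measurable_lerchKernel (β r c : ℝ) : Measurable (lerchKernel β r c) := by
  unfold lerchKernel; fun_prop

lemma integrableOn_pow_mul_lerchKernel {β : ℝ} (hβ : β = 1 ∨ β = -1) {r c : ℝ} (hr : 0 < r)
    (hc : 0 < c) {k : ℕ} (hk : β = 1 → k ≠ 0) :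
    IntegrableOn (fun v => v ^ k * lerchKernel β r c v) (Ioi 0) := by
  have hmeas : Measurable (fun v => v ^ k * lerchKernel β r c v) := by fun_prop
  rcases hβ with hβ1 | rfl
  · obtain ⟨l, rfl⟩ := Nat.exists_eq_succ_of_ne_zero (hk hβ1)
    have hi := (integrableOn_pow_mul_exp_neg (l + 1) hc).add
      ((integrableOn_pow_mul_exp_neg l hc).mul_const r⁻¹)
    refine hi.mono' hmeas.aestronglyMeasurable ?_
    filter_upwards [ae_restrict_mem measurableSet_Ioi] with v hv
    have hv : 0 < v := hv
    have h1 := inv_one_sub_mul_exp_neg_le (Or.inl hβ1) (mul_pos hr hv)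
    have h0 := one_sub_mul_exp_neg_pos (Or.inl hβ1) (mul_pos hr hv)
    rw [Real.norm_of_nonneg (by unfold lerchKernel; positivity)]
    calc v ^ (l + 1) * lerchKernel β r c v
        = v ^ (l + 1) * Real.exp (-(c * v)) * (1 / (1 - β * Real.exp (-(r * v)))) := by
          unfold lerchKernel; ring
      _ ≤ v ^ (l + 1) * Real.exp (-(c * v)) * (1 + (r * v)⁻¹) := by gcongr
      _ = _ := by simp only [Pi.add_apply]; field_simp; ring
  · refine (integrableOn_pow_mul_exp_neg k hc).mono' hmeas.aestronglyMeasurable ?_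
    filter_upwards [ae_restrict_mem measurableSet_Ioi] with v hv
    have hv : 0 < v := hv
    have h2 := Real.exp_pos (-(r * v))
    unfold lerchKernel
    rw [Real.norm_of_nonneg (mul_nonneg (by positivity) (div_nonneg (by positivity) (by linarith)))]
    gcongr
    apply div_le_self (by positivity) (by linarith)

lemma lerchKernel_eq_sum_add {β : ℝ} (hβ : β = 1 ∨ β = -1) {r c v : ℝ} (hr : 0 < r) (hv : 0 < v)
    (N : ℕ) : lerchKernel β r c v =
      ∑ m ∈ Finset.range N, β ^ m * Real.exp (-((c + r * m) * v)) +
        β ^ N * (Real.exp (-(r * v)) ^ N * lerchKernel β r c v) := by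
  have h0 := one_sub_mul_exp_neg_pos hβ (mul_pos hr hv)
  have h1 : ∀ m : ℕ, β ^ m * Real.exp (-((c + r * m) * v)) =
      Real.exp (-(c * v)) * (β * Real.exp (-(r * v))) ^ m := by
    intro m
    rw [mul_pow, ← Real.exp_nat_mul, mul_left_comm, ← Real.exp_add]
    ring_nf
  simp_rw [h1]
  rw [← Finset.mul_sum, geom_sum_eq (by linarith)]
  unfold lerchKernel
  rw [← mul_assoc (β ^ N), ← mul_pow]
  generalize (β * Real.exp (-(r * v))) ^ N = X
  rw [show β * Real.exp (-(r * v)) - 1 = -(1 - β * Real.exp (-(r * v))) by ring]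
  field_simp
  ring

/-- The remainder of the geometric expansion of a Lerch kernel disappears after integration. -/
lemma tendsto_integral_exp_pow_mul {r : ℝ} (hr : 0 < r) {F : ℝ → ℝ} (hF : IntegrableOn F (Ioi 0)) :
    Tendsto (fun N : ℕ => ∫ v in Ioi (0 : ℝ), Real.exp (-(r * v)) ^ N * F v) atTop (𝓝 0) := by
  have h := tendsto_integral_of_dominated_convergence (μ := volume.restrict (Ioi (0 : ℝ)))
    (F := fun (N : ℕ) v => Real.exp (-(r * v)) ^ N * F v) (f := fun _ => 0) (fun v => ‖F v‖)
    (fun N => (Continuous.aestronglyMeasurable (by fun_prop)).mul hF.aestronglyMeasurable)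
    hF.norm ?_ ?_
  · simpa using h
  · intro N
    filter_upwards [ae_restrict_mem measurableSet_Ioi] with v hv
    have hv : 0 < r * v := mul_pos hr hv
    rw [norm_mul, norm_pow, Real.norm_of_nonneg (Real.exp_pos _).le]
    exact mul_le_of_le_one_left (norm_nonneg _)
      (pow_le_one₀ (Real.exp_pos _).le (by simpa using hv.le))
  · filter_upwards [ae_restrict_mem measurableSet_Ioi] with v hv
    have hv : 0 < r * v := mul_pos hr hv
    simpa using (tendsto_pow_atTop_nhds_zero_of_lt_one (Real.exp_pos _).le
      (by simpa using hv : Real.exp (-(r * v)) < 1)).mul_const (F v)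

lemma tendsto_sign_pow_mul {β : ℝ} (hβ : β = 1 ∨ β = -1) {u : ℕ → ℝ} (hu : Tendsto u atTop (𝓝 0)) :
    Tendsto (fun N => β ^ N * u N) atTop (𝓝 0) := by
  refine squeeze_zero_norm (fun N => ?_) (by simpa using hu.norm)
  rcases hβ with rfl | rfl <;> simp

lemma hasSum_conditional_nat {u : ℕ → ℝ} {l : ℝ} :
    HasSum u l (SummationFilter.conditional ℕ) ↔
      Tendsto (fun N => ∑ m ∈ Finset.range N, u m) atTop (𝓝 l) := by
  rw [HasSum, SummationFilter.conditional_filter_eq_map_range]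
  rfl

lemma lerchPhi_eq_of_tendsto {β α l : ℝ} {k : ℕ} (hk : k ≠ 0)
    (h : Tendsto (fun N => ∑ m ∈ Finset.range N, β ^ m / ((m : ℝ) + α) ^ k) atTop (𝓝 l)) :
    lerchPhi β k α = l := by
  rw [lerchPhi, if_neg hk]
  exact (hasSum_conditional_nat.2 h).tsum_eq

/-- The moments of a Lerch kernel: `∫₀^∞ v^k e^{-cv} / (1 - β e^{-rv}) dv`. -/
lemma integral_pow_mul_lerchKernel {β : ℝ} (hβ : β = 1 ∨ β = -1) {r c : ℝ} (hr : 0 < r)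
    (hc : 0 < c) {k : ℕ} (hk : β = 1 → k ≠ 0) :
    ∫ v in Ioi (0 : ℝ), v ^ k * lerchKernel β r c v =
      k.factorial * (r ^ (k + 1))⁻¹ * lerchPhi β (k + 1) (c / r) := by
  set I := ∫ v in Ioi (0 : ℝ), v ^ k * lerchKernel β r c v with hI
  have hint := integrableOn_pow_mul_lerchKernel hβ hr hc hk
  have hcm : ∀ m : ℕ, 0 < c + r * m := fun m => by positivity
  have hexp : ∀ N : ℕ, ∑ m ∈ Finset.range N, β ^ m / ((m : ℝ) + c / r) ^ (k + 1) =
      r ^ (k + 1) / k.factorial * (I - β ^ N *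
        ∫ v in Ioi (0 : ℝ), Real.exp (-(r * v)) ^ N * (v ^ k * lerchKernel β r c v)) := by
    intro N
    have hrem : IntegrableOn (fun v => Real.exp (-(r * v)) ^ N * (v ^ k * lerchKernel β r c v))
        (Ioi 0) := by
      refine hint.norm.mono' ((Continuous.aestronglyMeasurable (by fun_prop)).mul
        hint.aestronglyMeasurable) ?_
      filter_upwards [ae_restrict_mem measurableSet_Ioi] with v hv
      have hv : 0 < r * v := mul_pos hr hv
      rw [norm_mul, norm_pow, Real.norm_of_nonneg (Real.exp_pos _).le]
      exact mul_le_of_le_one_left (norm_nonneg _)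
        (pow_le_one₀ (Real.exp_pos _).le (by simpa using hv.le))
    have h1 : I = ∑ m ∈ Finset.range N, β ^ m * (k.factorial / (c + r * m) ^ (k + 1)) + β ^ N *
        ∫ v in Ioi (0 : ℝ), Real.exp (-(r * v)) ^ N * (v ^ k * lerchKernel β r c v) := by
      simp_rw [← integral_pow_mul_exp_neg k (hcm _), ← integral_const_mul]
      rw [← integral_finsetSum _ (fun m _ => (integrableOn_pow_mul_exp_neg k (hcm m)).const_mul _),
        ← integral_add (integrable_finsetSum _
          (fun m _ => (integrableOn_pow_mul_exp_neg k (hcm m)).const_mul _)) (hrem.const_mul _)]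
      refine setIntegral_congr_fun measurableSet_Ioi fun v hv => ?_
      conv_lhs => rw [lerchKernel_eq_sum_add hβ hr hv N]
      rw [mul_add, Finset.mul_sum]
      congr 1
      · exact Finset.sum_congr rfl fun m _ => by ring
      · ring
    rw [h1, add_sub_cancel_right, Finset.mul_sum]
    refine Finset.sum_congr rfl fun m _ => ?_
    have h2 : (c + r * m) = r * (m + c / r) := by field_simp; ring
    have h3 : ((m : ℝ) + c / r) ≠ 0 := by positivity
    have h4 : (k.factorial : ℝ) ≠ 0 := by positivity
    rw [h2, mul_pow]
    field_simp
  have hlim : Tendsto (fun N => ∑ m ∈ Finset.range N, β ^ m / ((m : ℝ) + c / r) ^ (k + 1)) atTop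
      (𝓝 (r ^ (k + 1) / k.factorial * (I - 0))) := by
    simp_rw [hexp]
    exact (tendsto_const_nhds.sub
      (tendsto_sign_pow_mul hβ (tendsto_integral_exp_pow_mul hr hint))).const_mul _
  rw [lerchPhi_eq_of_tendsto k.succ_ne_zero hlim, sub_zero]
  have h4 : (k.factorial : ℝ) ≠ 0 := by positivity
  field_simp

/-- The Mittag-Leffler expansion of the cotangent, arranged as a difference of two divergent Lerch
series. -/
lemma tendsto_sum_inv_add_sub_inv_add {α : ℝ} (h0 : 0 < α) (h1 : α < 1) :
    Tendsto (fun N : ℕ => ∑ m ∈ Finset.range N, (1 / ((m : ℝ) + α) - 1 / (m + (1 - α)))) atTop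
      (𝓝 (Real.pi * Real.cot (Real.pi * α))) := by
  have hx : (α : ℂ) ∈ Complex.integerComplement := by
    rw [Complex.mem_integerComplement_iff]
    rintro ⟨m, hm⟩
    have hm : (m : ℝ) = α := by exact_mod_cast hm
    rw [← hm] at h0 h1
    have h0 : 0 < m := by exact_mod_cast h0
    have h1 : m < 1 := by exact_mod_cast h1
    omega
  have hc := tendsto_logDeriv_euler_cot_sub hx
  have hlim : Tendsto (fun N : ℕ => 1 / (α : ℂ) + ∑ j ∈ Finset.range N, cotTerm α j -
      ((1 / ((N : ℝ) + α) : ℝ) : ℂ)) atTop (𝓝 (1 / (α : ℂ) +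
        (Real.pi * Complex.cot (Real.pi * α) - 1 / α) - ((0 : ℝ) : ℂ))) := by
    refine (hc.const_add _).sub ((Complex.continuous_ofReal.tendsto _).comp ?_)
    simp_rw [one_div]
    exact tendsto_inv_atTop_zero.comp (tendsto_natCast_atTop_atTop.atTop_add tendsto_const_nhds)
  have hre := (Complex.continuous_re.tendsto _).comp hlim
  have hl : (1 / (α : ℂ) + (Real.pi * Complex.cot (Real.pi * α) - 1 / α) - ((0 : ℝ) : ℂ)) =
      ((Real.pi * Real.cot (Real.pi * α) : ℝ) : ℂ) := by push_cast; ring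
  rw [hl, Complex.ofReal_re] at hre
  refine hre.congr fun N => ?_
  have hs : 1 / (α : ℂ) + ∑ j ∈ Finset.range N, cotTerm α j - ((1 / ((N : ℝ) + α) : ℝ) : ℂ) =
      ((∑ m ∈ Finset.range N, (1 / ((m : ℝ) + α) - 1 / (m + (1 - α))) : ℝ) : ℂ) := by
    have hN : (1 : ℝ) / α + ∑ j ∈ Finset.range N, (1 / (α - (j + 1)) + 1 / (α + (j + 1))) -
        1 / ((N : ℝ) + α) = ∑ m ∈ Finset.range N, (1 / ((m : ℝ) + α) - 1 / (m + (1 - α))) := by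
      induction N with
      | zero => simp
      | succ N ih =>
        rw [Finset.sum_range_succ, Finset.sum_range_succ, ← ih]
        have : 1 / (α - (N + 1)) = - (1 / (N + (1 - α))) := by
          rw [← one_div_neg_eq_neg_one_div]; ring_nf
        rw [this]; push_cast; ring_nf
    rw [← hN]; push_cast; rfl
  simp only [Function.comp_apply]
  rw [hs, Complex.ofReal_re]

lemma abs_exp_neg_sub_exp_neg_le {c d v : ℝ} (hv : 0 ≤ v) :
    |Real.exp (-(c * v)) - Real.exp (-(d * v))| ≤
      |d - c| * v * (Real.exp (-(c * v)) + Real.exp (-(d * v))) := by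
  wlog h : c ≤ d generalizing c d
  · have := this (c := d) (d := c) (by linarith)
    rwa [abs_sub_comm, abs_sub_comm d c, add_comm (Real.exp _)]
  have h1 : Real.exp (-(d * v)) ≤ Real.exp (-(c * v)) := Real.exp_le_exp.2 (by nlinarith)
  rw [abs_of_nonneg (by linarith), abs_of_nonneg (by linarith)]
  have h2 : Real.exp (-(d * v)) = Real.exp (-(c * v)) * Real.exp (-((d - c) * v)) := by
    rw [← Real.exp_add]; ring_nf
  have h3 := Real.one_sub_le_exp_neg ((d - c) * v)
  have h4 := Real.exp_pos (-(c * v))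
  have h5 := Real.exp_pos (-(d * v))
  have h6 : 0 ≤ (d - c) * v := mul_nonneg (by linarith) hv
  have : 0 ≤ (d - c) * v * Real.exp (-(d * v)) := by positivity
  rw [mul_add]
  nlinarith

lemma integrableOn_lerchKernel_sub {β : ℝ} (hβ : β = 1 ∨ β = -1) {r c d : ℝ} (hr : 0 < r)
    (hc : 0 < c) (hd : 0 < d) :
    IntegrableOn (fun v => lerchKernel β r c v - lerchKernel β r d v) (Ioi 0) := by
  have hi := ((integrableOn_pow_mul_lerchKernel hβ hr hc (k := 1) (by simp)).add
    (integrableOn_pow_mul_lerchKernel hβ hr hd (k := 1) (by simp))).const_mul |d - c|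
  refine hi.mono' (Measurable.aestronglyMeasurable (by fun_prop)) ?_
  filter_upwards [ae_restrict_mem measurableSet_Ioi] with v hv
  have hv : 0 < v := hv
  have h0 := one_sub_mul_exp_neg_pos hβ (mul_pos hr hv)
  simp only [lerchKernel, Pi.add_apply]
  rw [← sub_div, Real.norm_eq_abs, abs_div, abs_of_pos h0, div_le_iff₀ h0]
  refine (abs_exp_neg_sub_exp_neg_le hv.le).trans_eq ?_
  generalize 1 - β * Real.exp (-(r * v)) = D at h0 ⊢
  field_simp

/-- The difference of two Lerch kernels is integrable although, for `β = 1`, neither of them is: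
this is the principal value behind `Θ(1, 1, s, r) = π cot(π s / r)`. -/
lemma integral_lerchKernel_sub {r c : ℝ} (hr : 0 < r) (hc : 0 < c) (hcr : c < r) :
    ∫ v in Ioi (0 : ℝ), (lerchKernel 1 r c v - lerchKernel 1 r (r - c) v) =
      r⁻¹ * (Real.pi * Real.cot (Real.pi * c / r)) := by
  have hd : 0 < r - c := by linarith
  have hint := integrableOn_lerchKernel_sub (Or.inl rfl : (1 : ℝ) = 1 ∨ (1 : ℝ) = -1) hr hc hd
  set I := ∫ v in Ioi (0 : ℝ), (lerchKernel 1 r c v - lerchKernel 1 r (r - c) v) with hI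
  have hcot := tendsto_sum_inv_add_sub_inv_add (α := c / r) (by positivity)
    (by rwa [div_lt_one hr])
  rw [← mul_div_assoc] at hcot
  have hexp : ∀ N : ℕ, ∑ m ∈ Finset.range N, (1 / ((m : ℝ) + c / r) - 1 / (m + (1 - c / r))) =
      r * (I - ∫ v in Ioi (0 : ℝ), Real.exp (-(r * v)) ^ N *
        (lerchKernel 1 r c v - lerchKernel 1 r (r - c) v)) := by
    intro N
    have hrem : IntegrableOn (fun v => Real.exp (-(r * v)) ^ N *
        (lerchKernel 1 r c v - lerchKernel 1 r (r - c) v)) (Ioi 0) := by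
      refine hint.norm.mono' ((Continuous.aestronglyMeasurable (by fun_prop)).mul
        hint.aestronglyMeasurable) ?_
      filter_upwards [ae_restrict_mem measurableSet_Ioi] with v hv
      have hv : 0 < r * v := mul_pos hr hv
      rw [norm_mul, norm_pow, Real.norm_of_nonneg (Real.exp_pos _).le]
      exact mul_le_of_le_one_left (norm_nonneg _)
        (pow_le_one₀ (Real.exp_pos _).le (by simpa using hv.le))
    have hE : ∀ e : ℝ, 0 < e → IntegrableOn (fun v : ℝ => Real.exp (-(e * v))) (Ioi 0) := by
      intro e he
      simpa using integrableOn_pow_mul_exp_neg 0 he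
    have hEv : ∀ e : ℝ, 0 < e → ∫ v in Ioi (0 : ℝ), Real.exp (-(e * v)) = 1 / e := by
      intro e he
      simpa using integral_pow_mul_exp_neg 0 he
    have h1 : I = ∑ m ∈ Finset.range N, (1 / (c + r * m) - 1 / (r - c + r * m)) +
        ∫ v in Ioi (0 : ℝ), Real.exp (-(r * v)) ^ N *
          (lerchKernel 1 r c v - lerchKernel 1 r (r - c) v) := by
      have hcm : ∀ m : ℕ, 0 < c + r * m := fun m => by positivity
      have hdm : ∀ m : ℕ, 0 < r - c + r * m := fun m => by positivity
      have : ∀ m : ℕ, 1 / (c + r * m) - 1 / (r - c + r * m) =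
          ∫ v in Ioi (0 : ℝ), (Real.exp (-((c + r * m) * v)) -
            Real.exp (-((r - c + r * m) * v))) := by
        intro m
        rw [integral_sub (hE _ (hcm m)) (hE _ (hdm m)), hEv _ (hcm m), hEv _ (hdm m)]
      simp_rw [this]
      have hsub : ∀ m : ℕ, IntegrableOn (fun v : ℝ => Real.exp (-((c + r * m) * v)) -
          Real.exp (-((r - c + r * m) * v))) (Ioi 0) := fun m => (hE _ (hcm m)).sub (hE _ (hdm m))
      rw [← integral_finsetSum _ (fun m _ => hsub m),
        ← integral_add (integrable_finsetSum _ (fun m _ => hsub m)) hrem]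
      refine setIntegral_congr_fun measurableSet_Ioi fun v hv => ?_
      conv_lhs => rw [lerchKernel_eq_sum_add (Or.inl rfl) hr hv N,
        lerchKernel_eq_sum_add (c := r - c) (Or.inl rfl) hr hv N]
      simp only [one_pow, one_mul, Finset.sum_sub_distrib]
      ring
    rw [h1, add_sub_cancel_right, Finset.mul_sum]
    refine Finset.sum_congr rfl fun m _ => ?_
    rw [mul_sub]
    congr 1 <;> field_simp <;> ring
  simp_rw [hexp] at hcot
  have h2 := tendsto_nhds_unique hcot
    ((tendsto_const_nhds.sub (tendsto_integral_exp_pow_mul hr hint)).const_mul r)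
  rw [h2, sub_zero]; field_simp

/-! ### Exchanging the order of integration around a simple pole -/

/-- An integrable function on `ℝ`, with an integrable singularity at `0`, used to dominate
integrands on product spaces. -/
noncomputable def decayBound (N : ℕ) (s : ℝ) : ℝ :=
  (1 + |s|) ^ N * (√|s|)⁻¹ * Real.exp (-(|s| / 4))

lemma decayBound_nonneg (N : ℕ) (s : ℝ) : 0 ≤ decayBound N s := by
  unfold decayBound; positivity

lemma integrable_decayBound (N : ℕ) : Integrable (decayBound N) := by
  have hpos : IntegrableOn (fun x : ℝ => (1 + x) ^ N * (√x)⁻¹ * Real.exp (-(x / 4))) (Ioi 0) := by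
    have h1 : ∀ k : ℕ, IntegrableOn
        (fun x : ℝ => x ^ ((k : ℝ) - 1 / 2) * Real.exp (-(1 / 4) * x ^ (1 : ℝ))) (Ioi 0) := by
      intro k
      refine integrableOn_rpow_mul_exp_neg_mul_rpow ?_ one_pos (by norm_num)
      have : (0 : ℝ) ≤ k := k.cast_nonneg
      linarith
    refine (((h1 0).add (h1 N)).const_mul (2 ^ (N - 1))).mono'
      (Measurable.aestronglyMeasurable (by fun_prop)) ?_
    filter_upwards [ae_restrict_mem measurableSet_Ioi] with x hx
    have hx : 0 < x := hx
    rw [Real.norm_of_nonneg (by positivity)]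
    have h2 : ∀ k : ℕ, x ^ ((k : ℝ) - 1 / 2) = x ^ k * (√x)⁻¹ := by
      intro k
      rw [Real.rpow_sub hx, Real.rpow_natCast, Real.sqrt_eq_rpow, div_eq_mul_inv]
    have h3 := add_pow_le zero_le_one hx.le N
    simp only [Pi.add_apply, h2, Real.rpow_one]
    calc (1 + x) ^ N * (√x)⁻¹ * Real.exp (-(x / 4))
        ≤ 2 ^ (N - 1) * (1 ^ N + x ^ N) * (√x)⁻¹ * Real.exp (-(x / 4)) := by gcongr
      _ = _ := by
        rw [show -(x / 4) = -(1 / 4) * x by ring]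
        simp only [one_pow, pow_zero]; ring
  have hIoi : IntegrableOn (decayBound N) (Ioi 0) := by
    refine hpos.congr_fun (fun x hx => ?_) measurableSet_Ioi
    rw [decayBound, abs_of_pos hx]
  have hIio : IntegrableOn (decayBound N) (Iio 0) := by
    rw [← neg_zero] at hIoi
    refine (hIoi.comp_neg_Iio).congr_fun (fun x _ => ?_) measurableSet_Iio
    simp [decayBound]
  rw [← restrict_compl_singleton (μ := volume) 0, ← Iio_union_Ioi]
  exact hIio.union hIoi

lemma exp_le_decayBound {N : ℕ} {s : ℝ} (hs : s ≠ 0) :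
    (1 + |s|) ^ N * Real.exp (-(|s| / 4)) ≤ decayBound (N + 1) s := by
  have h0 : 0 < √|s| := Real.sqrt_pos.2 (abs_pos.2 hs)
  have h1 : 1 ≤ (1 + |s|) * (√|s|)⁻¹ := by
    rw [← div_eq_mul_inv, one_le_div h0]
    nlinarith [Real.sq_sqrt (abs_nonneg s), sq_nonneg (√|s| - 1)]
  unfold decayBound
  calc (1 + |s|) ^ N * Real.exp (-(|s| / 4))
      ≤ (1 + |s|) ^ N * Real.exp (-(|s| / 4)) * ((1 + |s|) * (√|s|)⁻¹) :=
        le_mul_of_one_le_right (by positivity) h1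
    _ = _ := by ring

lemma integrable_prod_of_le_decayBound {S T : Set ℝ} (hS : MeasurableSet S) (hT : MeasurableSet T)
    {F : ℝ × ℝ → ℝ} (hF : Measurable F) (M N : ℕ) (K : ℝ)
    (h : ∀ s ∈ S, ∀ v ∈ T, |F (s, v)| ≤ K * (decayBound M s * decayBound N v)) :
    Integrable F ((volume.restrict S).prod (volume.restrict T)) := by
  refine (((integrable_decayBound M).restrict.mul_prod
    (integrable_decayBound N).restrict).const_mul K).mono' hF.aestronglyMeasurable ?_
  rw [Measure.prod_restrict]
  filter_upwards [ae_restrict_mem (hS.prod hT)] with z hz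
  exact h z.1 hz.1 z.2 hz.2

/-- The truncated power `t₊^m`. -/
noncomputable def truncPow (m : ℕ) (t : ℝ) : ℝ := if 0 < t then t ^ m else 0

@[fun_prop]
lemma measurable_truncPow (m : ℕ) : Measurable (truncPow m) :=
  Measurable.ite measurableSet_Ioi (by fun_prop) measurable_const

lemma truncPow_of_pos {m : ℕ} {t : ℝ} (ht : 0 < t) : truncPow m t = t ^ m := if_pos ht

lemma truncPow_of_nonpos {m : ℕ} {t : ℝ} (ht : t ≤ 0) : truncPow m t = 0 := if_neg ht.not_gt

lemma truncPow_nonneg (m : ℕ) (t : ℝ) : 0 ≤ truncPow m t := by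
  unfold truncPow; split_ifs <;> positivity

lemma truncPow_le {m : ℕ} {t u : ℝ} (h : t ≤ u) (hu : 0 ≤ u) : truncPow m t ≤ u ^ m := by
  unfold truncPow; split_ifs with h0
  · gcongr
  · positivity

/-- A Hölder bound of exponent `1/2` for truncated powers. For `m = 0` no Lipschitz bound holds,
and the singularity of the bound at `s = 0` is the price. -/
lemma abs_truncPow_add_sub_truncPow_sub_le (m : ℕ) {s v : ℝ} (hs : s ≠ 0) (hv : 0 < v) :
    |truncPow m (s + v) - truncPow m (s - v)| ≤
      2 * (m + 1) * (|s| + v) ^ m * (√v * (√|s|)⁻¹) := by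
  have hs0 : 0 < |s| := abs_pos.2 hs
  have hr0 : 0 < √|s| := Real.sqrt_pos.2 hs0
  have hA : truncPow m (s + v) ≤ (|s| + v) ^ m :=
    truncPow_le (by linarith [le_abs_self s]) (by positivity)
  have hB : truncPow m (s - v) ≤ (|s| + v) ^ m :=
    truncPow_le (by linarith [le_abs_self s]) (by positivity)
  have hA0 := truncPow_nonneg m (s + v)
  have hB0 := truncPow_nonneg m (s - v)
  have hm : (0 : ℝ) ≤ m := m.cast_nonneg
  rcases le_or_gt |s| v with h | h
  · have h1 : 1 ≤ √v * (√|s|)⁻¹ := by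
      rw [← div_eq_mul_inv, one_le_div hr0]; exact Real.sqrt_le_sqrt h
    calc |truncPow m (s + v) - truncPow m (s - v)| ≤ (|s| + v) ^ m := by
          rw [abs_le]; constructor <;> linarith
      _ ≤ 2 * (m + 1) * (|s| + v) ^ m * 1 := by
          have : 0 ≤ (|s| + v) ^ m := by positivity
          nlinarith
      _ ≤ _ := by gcongr
  · rcases lt_or_gt_of_ne hs with hneg | hpos
    · rw [abs_of_neg hneg] at h
      rw [truncPow_of_nonpos (by linarith), truncPow_of_nonpos (by linarith)]
      simp; positivity
    · rw [abs_of_pos hpos] at *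
      rw [truncPow_of_pos (by linarith), truncPow_of_pos (by linarith)]
      have hle : (s - v) ^ m ≤ (s + v) ^ m := by
        apply pow_le_pow_left₀ <;> linarith
      rw [abs_of_nonneg (by linarith)]
      have h2 : (s + v) ^ m - (s - v) ^ m ≤ 2 * m * (s + v) ^ m * (v / s) := by
        rcases Nat.eq_zero_or_pos m with rfl | hm0
        · simp
        · obtain ⟨l, rfl⟩ := Nat.exists_eq_succ_of_ne_zero hm0.ne'
          have := abs_pow_sub_pow_le (s + v) (s - v) (l + 1)
          rw [abs_of_nonneg (by simpa using hle), show s + v - (s - v) = 2 * v by ring,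
            abs_of_pos (a := 2 * v) (by linarith), abs_of_pos (a := s + v) (by linarith),
            abs_of_pos (a := s - v) (by linarith), max_eq_left (by linarith)] at this
          refine this.trans ?_
          simp only [Nat.add_sub_cancel]
          rw [mul_div_assoc', le_div_iff₀ hpos]
          have h3 : (s + v) ^ l * s ≤ (s + v) ^ (l + 1) := by
            rw [pow_succ]; gcongr; linarith
          have h4 : (0:ℝ) ≤ 2 * (l + 1 : ℕ) * v := by positivity
          have := mul_le_mul_of_nonneg_left h3 h4
          simp only [Nat.succ_eq_add_one]
          nlinarith
      have h5 : v / s ≤ √v * (√s)⁻¹ := by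
        rw [← div_eq_mul_inv, ← Real.sqrt_div hv.le]
        apply Real.le_sqrt_of_sq_le
        have : v / s ≤ 1 := by rw [div_le_one hpos]; exact h.le
        have h0 : 0 ≤ v / s := by positivity
        nlinarith
      refine h2.trans ?_
      gcongr
      linarith

lemma add_pow_le_one_add_pow_mul {s v : ℝ} (hs : 0 ≤ s) (hv : 0 ≤ v) (m : ℕ) :
    (s + v) ^ m ≤ (1 + s) ^ m * (1 + v) ^ m := by
  rw [← mul_pow]
  gcongr
  nlinarith [mul_nonneg hs hv]

lemma one_add_add_pow_le {s v : ℝ} (hs : 0 ≤ s) (hv : 0 ≤ v) (m : ℕ) :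
    (1 + s + v) ^ m ≤ (1 + s) ^ m * (1 + v) ^ m := by
  rw [← mul_pow]
  gcongr
  nlinarith [mul_nonneg hs hv]

section Exchange

variable {h g : ℝ → ℝ} {C : ℝ} {N : ℕ} (m : ℕ)

lemma integrable_mul_truncPow_add (hh : Measurable h)
    (hb : ∀ s, |h s| ≤ C * (1 + |s|) ^ N * Real.exp (-max s 0)) (v : ℝ) :
    Integrable fun s => h s * truncPow m (s + v) := by
  have hC : 0 ≤ C := by have := (abs_nonneg _).trans (hb 0); simpa using this
  refine ((integrable_decayBound (N + m + 1)).const_mul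
    (C * (1 + |v|) ^ m * Real.exp (|v| / 4))).mono'
    (Measurable.aestronglyMeasurable (by fun_prop)) ?_
  filter_upwards [compl_mem_ae_iff.2 (measure_singleton (0 : ℝ))] with s hs
  have hs : s ≠ 0 := hs
  rw [norm_mul, Real.norm_eq_abs, Real.norm_of_nonneg (truncPow_nonneg _ _)]
  rcases le_or_gt (s + v) 0 with h0 | h0
  · rw [truncPow_of_nonpos h0, mul_zero]
    have := decayBound_nonneg (N + m + 1) s
    positivity
  · have h1 : truncPow m (s + v) ≤ (1 + |s|) ^ m * (1 + |v|) ^ m :=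
      (truncPow_le (by linarith [le_abs_self s, le_abs_self v]) (by positivity)).trans
        (add_pow_le_one_add_pow_mul (abs_nonneg s) (abs_nonneg v) m)
    have h2 : Real.exp (-max s 0) ≤ Real.exp (|v| / 4) * Real.exp (-(|s| / 4)) := by
      rw [← Real.exp_add, Real.exp_le_exp]
      have := le_abs_self v
      rcases le_total 0 s with h3 | h3
      · rw [max_eq_left h3, abs_of_nonneg h3]
        have := abs_nonneg v
        linarith
      · rw [max_eq_right h3, abs_of_nonpos h3]; linarith
    calc |h s| * truncPow m (s + v) ≤ (C * (1 + |s|) ^ N *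
          (Real.exp (|v| / 4) * Real.exp (-(|s| / 4)))) * ((1 + |s|) ^ m * (1 + |v|) ^ m) := by
          gcongr
          · exact truncPow_nonneg _ _
          · exact (hb s).trans (by gcongr)
      _ = C * (1 + |v|) ^ m * Real.exp (|v| / 4) *
          ((1 + |s|) ^ (N + m) * Real.exp (-(|s| / 4))) := by rw [pow_add]; ring
      _ ≤ _ := by gcongr; exact exp_le_decayBound hs

/-- Absolute integrability on the product space before the exchange; the factor `e^{s/4}` gained
from `s + v > 0` compensates the growth of `h` at `-∞`. -/
lemma integrable_prod_mul_truncPow (hh : Measurable h) (hg : Measurable g)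
    (hgb : ∀ v, 0 < v → |g v| ≤ v⁻¹ * Real.exp (-(v / 2)))
    (hb : ∀ s, |h s| ≤ C * (1 + |s|) ^ N * Real.exp (-max s 0)) :
    Integrable (fun z : ℝ × ℝ => h z.1 *
      (g z.2 * truncPow m (z.1 + z.2) + (-1 - g z.2) * truncPow m (z.1 - z.2)))
      (volume.prod (volume.restrict (Ioi 0))) := by
  have hC : 0 ≤ C := by have := (abs_nonneg _).trans (hb 0); simpa using this
  have hvol : (volume : Measure ℝ) = volume.restrict {0}ᶜ :=
    (restrict_compl_singleton 0).symm
  have hz : MeasurableSet ({0}ᶜ : Set ℝ) := (measurableSet_singleton 0).compl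
  have h1 : Integrable (fun z : ℝ × ℝ => h z.1 *
      (g z.2 * (truncPow m (z.1 + z.2) - truncPow m (z.1 - z.2))))
      (volume.prod (volume.restrict (Ioi 0))) := by
    rw [hvol, Measure.restrict_restrict_of_subset (by simp)]
    refine integrable_prod_of_le_decayBound hz measurableSet_Ioi (by fun_prop) (N + m) m
      (2 * (m + 1) * C) ?_
    intro s hs v hv
    have hs : s ≠ 0 := hs
    have hv : 0 < v := hv
    have hs0 : 0 < |s| := abs_pos.2 hs
    have hB := mul_nonneg (decayBound_nonneg (N + m) s) (decayBound_nonneg m v)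
    simp only
    rcases le_or_gt (s + v) 0 with h0 | h0
    · rw [truncPow_of_nonpos h0, truncPow_of_nonpos (by linarith)]
      simp; positivity
    · have h2 : Real.exp (-max s 0) ≤ Real.exp (v / 4) * Real.exp (-(|s| / 4)) := by
        rw [← Real.exp_add, Real.exp_le_exp]
        rcases le_total 0 s with h3 | h3
        · rw [max_eq_left h3, abs_of_nonneg h3]; linarith
        · rw [max_eq_right h3, abs_of_nonpos h3]; linarith
      have h3 := (abs_truncPow_add_sub_truncPow_sub_le m hs hv)
      have h4 := add_pow_le_one_add_pow_mul hs0.le hv.le m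
      have h5 : Real.exp (v / 4) * Real.exp (-(v / 2)) = Real.exp (-(v / 4)) := by
        rw [← Real.exp_add]; ring_nf
      have h6 : v⁻¹ * √v = (√v)⁻¹ := by
        have : √v ≠ 0 := (Real.sqrt_pos.2 hv).ne'
        field_simp
        exact Real.sq_sqrt hv.le
      rw [abs_mul, abs_mul]
      calc |h s| * (|g v| * |truncPow m (s + v) - truncPow m (s - v)|)
          ≤ (C * (1 + |s|) ^ N * (Real.exp (v / 4) * Real.exp (-(|s| / 4)))) *
            ((v⁻¹ * Real.exp (-(v / 2))) * (2 * (m + 1) * ((1 + |s|) ^ m * (1 + v) ^ m) *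
              (√v * (√|s|)⁻¹))) := by
            gcongr
            · exact (hb s).trans (by gcongr)
            · exact hgb v hv
            · exact h3.trans (by gcongr)
        _ = 2 * (m + 1) * C * (((1 + |s|) ^ N * (1 + |s|) ^ m * (√|s|)⁻¹ * Real.exp (-(|s| / 4))) *
              ((1 + v) ^ m * (v⁻¹ * √v) * (Real.exp (v / 4) * Real.exp (-(v / 2))))) := by ring
        _ = _ := by
            rw [h5, h6, decayBound, decayBound, pow_add, abs_of_pos hv]
  have h2 : Integrable (fun z : ℝ × ℝ => h z.1 * truncPow m (z.1 - z.2))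
      (volume.prod (volume.restrict (Ioi 0))) := by
    rw [hvol, Measure.restrict_restrict_of_subset (by simp)]
    refine integrable_prod_of_le_decayBound hz measurableSet_Ioi (by fun_prop) (N + m + 1) 1 C ?_
    intro s hs v hv
    have hv : 0 < v := hv
    have hB := mul_nonneg (decayBound_nonneg (N + m + 1) s) (decayBound_nonneg 1 v)
    simp only
    rcases le_or_gt (s - v) 0 with h0 | h0
    · rw [truncPow_of_nonpos h0]
      simp; positivity
    · have hs0 : 0 < s := by linarith
      have h3 : truncPow m (s - v) ≤ (1 + |s|) ^ m :=
        truncPow_le (by linarith [le_abs_self s]) (by positivity)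
      have h4 : Real.exp (-max s 0) ≤ Real.exp (-(|s| / 4)) * Real.exp (-(|v| / 4)) := by
        rw [← Real.exp_add, Real.exp_le_exp, max_eq_left hs0.le, abs_of_pos hs0, abs_of_pos hv]
        linarith
      have h5 := exp_le_decayBound (N := 0) hv.ne'
      rw [abs_mul, abs_of_nonneg (truncPow_nonneg _ _)]
      calc |h s| * truncPow m (s - v)
          ≤ (C * (1 + |s|) ^ N * (Real.exp (-(|s| / 4)) * Real.exp (-(|v| / 4)))) *
            (1 + |s|) ^ m := by
            gcongr
            · exact truncPow_nonneg _ _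
            · exact (hb s).trans (by gcongr)
        _ = C * (((1 + |s|) ^ (N + m) * Real.exp (-(|s| / 4))) *
            ((1 + |v|) ^ 0 * Real.exp (-(|v| / 4)))) := by rw [pow_add]; ring
        _ ≤ _ := by
            gcongr
            · exact decayBound_nonneg _ _
            · exact exp_le_decayBound hs
  refine (h1.sub h2).congr (ae_of_all _ fun z => ?_)
  simp only [Pi.sub_apply]; ring

/-- Absolute integrability on the product space after the exchange. -/
lemma integrable_prod_pow_mul_symm (hh : Measurable h) (hg : Measurable g)
    (hgb : ∀ v, 0 < v → |g v| ≤ v⁻¹ * Real.exp (-(v / 2)))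
    (hb : ∀ s, |h s| ≤ C * (1 + |s|) ^ N * Real.exp (-max s 0))
    (hd : ∀ t v, 0 < t → 0 < v →
      |h (t - v) - h (t + v)| ≤ C * v * (1 + t + v) ^ N * Real.exp (-((t - v) / 4))) :
    Integrable (fun z : ℝ × ℝ => z.1 ^ m *
      (g z.2 * h (z.1 - z.2) + (-1 - g z.2) * h (z.1 + z.2)))
      ((volume.restrict (Ioi 0)).prod (volume.restrict (Ioi 0))) := by
  have hC : 0 ≤ C := by have := (abs_nonneg _).trans (hb 0); simpa using this
  have h1 : Integrable (fun z : ℝ × ℝ => z.1 ^ m * (g z.2 * (h (z.1 - z.2) - h (z.1 + z.2))))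
      ((volume.restrict (Ioi 0)).prod (volume.restrict (Ioi 0))) := by
    refine integrable_prod_of_le_decayBound measurableSet_Ioi measurableSet_Ioi (by fun_prop)
      (m + N + 1) (N + 1) C ?_
    intro t ht v hv
    have ht : 0 < t := ht
    have hv : 0 < v := hv
    simp only
    rw [abs_mul, abs_mul, abs_of_pos (pow_pos ht m)]
    have h5 : Real.exp (-((t - v) / 4)) * Real.exp (-(v / 2)) =
        Real.exp (-(|t| / 4)) * Real.exp (-(|v| / 4)) := by
      rw [← Real.exp_add, ← Real.exp_add, abs_of_pos hv, abs_of_pos ht]; ring_nf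
    calc t ^ m * (|g v| * |h (t - v) - h (t + v)|)
        ≤ (1 + |t|) ^ m * ((v⁻¹ * Real.exp (-(v / 2))) *
          (C * v * ((1 + |t|) ^ N * (1 + |v|) ^ N) * Real.exp (-((t - v) / 4)))) := by
          gcongr
          · rw [abs_of_pos ht]; linarith
          · exact hgb v hv
          · refine (hd t v ht hv).trans ?_
            gcongr
            rw [abs_of_pos ht, abs_of_pos hv]
            exact one_add_add_pow_le ht.le hv.le N
      _ = C * (v⁻¹ * v) * ((1 + |t|) ^ (m + N) * (1 + |v|) ^ N *
            (Real.exp (-((t - v) / 4)) * Real.exp (-(v / 2)))) := by rw [pow_add]; ring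
      _ = C * (((1 + |t|) ^ (m + N) * Real.exp (-(|t| / 4))) *
            ((1 + |v|) ^ N * Real.exp (-(|v| / 4)))) := by
          rw [h5, inv_mul_cancel₀ hv.ne']; ring
      _ ≤ _ := by
          gcongr
          · exact decayBound_nonneg _ _
          · exact exp_le_decayBound ht.ne'
          · exact exp_le_decayBound hv.ne'
  have h2 : Integrable (fun z : ℝ × ℝ => z.1 ^ m * h (z.1 + z.2))
      ((volume.restrict (Ioi 0)).prod (volume.restrict (Ioi 0))) := by
    refine integrable_prod_of_le_decayBound measurableSet_Ioi measurableSet_Ioi (by fun_prop)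
      (m + N + 1) (N + 1) C ?_
    intro t ht v hv
    have ht : 0 < t := ht
    have hv : 0 < v := hv
    simp only
    rw [abs_mul, abs_of_pos (pow_pos ht m)]
    have h4 : Real.exp (-max (t + v) 0) ≤ Real.exp (-(|t| / 4)) * Real.exp (-(|v| / 4)) := by
      rw [← Real.exp_add, Real.exp_le_exp, max_eq_left (by linarith), abs_of_pos ht, abs_of_pos hv]
      linarith
    calc t ^ m * |h (t + v)|
        ≤ (1 + |t|) ^ m * (C * ((1 + |t|) ^ N * (1 + |v|) ^ N) *
          (Real.exp (-(|t| / 4)) * Real.exp (-(|v| / 4)))) := by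
          gcongr
          · rw [abs_of_pos ht]; linarith
          · refine (hb _).trans ?_
            gcongr
            rw [abs_of_pos ht, abs_of_pos hv, abs_of_pos (by linarith), ← add_assoc]
            exact one_add_add_pow_le ht.le hv.le N
      _ = C * (((1 + |t|) ^ (m + N) * Real.exp (-(|t| / 4))) *
            ((1 + |v|) ^ N * Real.exp (-(|v| / 4)))) := by rw [pow_add]; ring
      _ ≤ _ := by
          gcongr
          · exact decayBound_nonneg _ _
          · exact exp_le_decayBound ht.ne'
          · exact exp_le_decayBound hv.ne'
  refine (h1.sub h2).congr (ae_of_all _ fun z => ?_)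
  simp only [Pi.sub_apply]; ring

lemma integral_mul_truncPow_add (v : ℝ) :
    ∫ s, h s * truncPow m (s + v) = ∫ t in Ioi (0 : ℝ), t ^ m * h (t - v) := by
  rw [← integral_sub_right_eq_self (fun s => h s * truncPow m (s + v)) v,
    ← integral_indicator measurableSet_Ioi]
  refine integral_congr_ae (ae_of_all _ fun t => ?_)
  simp only [sub_add_cancel, indicator, mem_Ioi, truncPow]
  split_ifs <;> ring

lemma integrableOn_pow_mul_comp_sub (hh : Measurable h)
    (hb : ∀ s, |h s| ≤ C * (1 + |s|) ^ N * Real.exp (-max s 0)) (v : ℝ) :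
    IntegrableOn (fun t => t ^ m * h (t - v)) (Ioi 0) := by
  rw [← integrable_indicator_iff measurableSet_Ioi]
  refine ((integrable_mul_truncPow_add m hh hb v).comp_sub_right v).congr (ae_of_all _ fun t => ?_)
  simp only [sub_add_cancel, indicator, mem_Ioi, truncPow]
  split_ifs <;> ring

/-- The principal-value convolution against a kernel with a simple pole at `0` may be moved from
`t₊^m` to `h`. The kernel is `g(-v)` for `v < 0` and `-1 - g(v)` for `v > 0`; the principal value
is encoded by adding the values at `v` and `-v` before integrating over `v > 0`. -/
theorem integral_mul_symm_convolution (hh : Measurable h) (hg : Measurable g)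
    (hgb : ∀ v, 0 < v → |g v| ≤ v⁻¹ * Real.exp (-(v / 2)))
    (hb : ∀ s, |h s| ≤ C * (1 + |s|) ^ N * Real.exp (-max s 0))
    (hd : ∀ t v, 0 < t → 0 < v →
      |h (t - v) - h (t + v)| ≤ C * v * (1 + t + v) ^ N * Real.exp (-((t - v) / 4))) :
    Integrable (fun s => h s * ∫ v in Ioi (0 : ℝ),
      (g v * truncPow m (s + v) + (-1 - g v) * truncPow m (s - v))) ∧
    ∫ s, h s * ∫ v in Ioi (0 : ℝ),
      (g v * truncPow m (s + v) + (-1 - g v) * truncPow m (s - v)) =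
    ∫ t in Ioi (0 : ℝ), t ^ m * ∫ v in Ioi (0 : ℝ),
      (g v * h (t - v) + (-1 - g v) * h (t + v)) := by
  have h1 := integrable_prod_mul_truncPow m hh hg hgb hb
  have h2 := integrable_prod_pow_mul_symm m hh hg hgb hb hd
  refine ⟨?_, ?_⟩
  · refine h1.integral_prod_left.congr (ae_of_all _ fun s => ?_)
    simp only [integral_const_mul]
  · simp_rw [← integral_const_mul]
    rw [integral_integral_swap h1]
    symm
    rw [integral_integral_swap h2]
    symm
    refine integral_congr_ae (ae_of_all _ fun v => ?_)
    have hi1 := (integrable_mul_truncPow_add m hh hb v).const_mul (g v)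
    have hi2 := (integrable_mul_truncPow_add m hh hb (-v)).const_mul (-1 - g v)
    have hj1 := (integrableOn_pow_mul_comp_sub m hh hb v).const_mul (g v)
    have hj2 := (integrableOn_pow_mul_comp_sub m hh hb (-v)).const_mul (-1 - g v)
    have e1 := integral_add hi1 hi2
    have e2 := integral_add hj1 hj2
    simp only [integral_const_mul, integral_mul_truncPow_add, sub_neg_eq_add] at e1 e2
    simp only [← sub_eq_add_neg] at e1
    calc ∫ s, h s * (g v * truncPow m (s + v) + (-1 - g v) * truncPow m (s - v))
        = ∫ s, (g v * (h s * truncPow m (s + v)) + (-1 - g v) * (h s * truncPow m (s - v))) := by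
          congr 1; ext s; ring
      _ = _ := e1
      _ = _ := e2.symm
      _ = _ := by congr 1
                  ext t
                  ring

end Exchange

/-! ### Weights `s^(q-1) / (1 - a e^s)` -/

section Weight

variable {W : ℝ → ℝ}

/-- A decreasing `W ≥ 0` for which `e^s W(s)` increases decays at most like `e^{-s}`, hence is
locally Lipschitz with a constant proportional to its value at the left end point. -/
lemma weight_sub_le_mul (hW0 : ∀ s, 0 ≤ W s)
    (hmono : Monotone fun s => Real.exp s * W s) {x y : ℝ} (hxy : x ≤ y) :
    W x - W y ≤ (y - x) * W x := by
  have h1 : Real.exp (x - y) * W x ≤ W y := by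
    have := hmono hxy
    simp only at this
    rw [Real.exp_sub, div_mul_eq_mul_div, div_le_iff₀ (Real.exp_pos y)]
    linarith
  have h2 := Real.add_one_le_exp (x - y)
  have h3 := mul_le_mul_of_nonneg_right h2 (hW0 x)
  linarith

lemma abs_pow_mul_weight_le (m : ℕ) (hW0 : ∀ s, 0 ≤ W s)
    (hle : ∀ s, W s ≤ (1 + |s|) * Real.exp (-max s 0)) (s : ℝ) :
    |s ^ m * W s| ≤ 2 * (m + 1) * (1 + |s|) ^ (m + 1) * Real.exp (-max s 0) := by
  have h1 : (1 : ℝ) ≤ 2 * (m + 1) := by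
    have : (0 : ℝ) ≤ m := m.cast_nonneg
    linarith
  rw [abs_mul, abs_pow, abs_of_nonneg (hW0 s)]
  calc |s| ^ m * W s ≤ (1 + |s|) ^ m * ((1 + |s|) * Real.exp (-max s 0)) := by
        gcongr
        · exact hW0 s
        · linarith
        · exact hle s
    _ = 1 * (1 + |s|) ^ (m + 1) * Real.exp (-max s 0) := by ring
    _ ≤ _ := by gcongr

lemma abs_pow_mul_weight_sub_le (m : ℕ) (hW0 : ∀ s, 0 ≤ W s) (hanti : Antitone W)
    (hmono : Monotone fun s => Real.exp s * W s)
    (hle : ∀ s, W s ≤ (1 + |s|) * Real.exp (-max s 0)) {t v : ℝ} (ht : 0 < t) (hv : 0 < v) :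
    |(t - v) ^ m * W (t - v) - (t + v) ^ m * W (t + v)| ≤
      2 * (m + 1) * v * (1 + t + v) ^ (m + 1) * Real.exp (-((t - v) / 4)) := by
  have habs : |t - v| ≤ t + v := by rw [abs_le]; constructor <;> linarith
  have h1 : W (t - v) ≤ (1 + t + v) * Real.exp (-((t - v) / 4)) := by
    refine (hle _).trans ?_
    gcongr ?_ * Real.exp (-?_)
    · linarith
    · rcases le_total 0 (t - v) with h | h
      · rw [max_eq_left h]; linarith
      · rw [max_eq_right h]; linarith
  have h2 : |(t - v) ^ m - (t + v) ^ m| ≤ 2 * v * m * (1 + t + v) ^ m := by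
    refine (abs_pow_sub_pow_le _ _ m).trans ?_
    rw [show t - v - (t + v) = -(2 * v) by ring, abs_neg, abs_of_pos (by linarith),
      abs_of_pos (a := t + v) (by linarith), max_eq_right habs]
    gcongr ?_ * ?_
    calc (t + v) ^ (m - 1) ≤ (1 + t + v) ^ (m - 1) := by gcongr; linarith
      _ ≤ (1 + t + v) ^ m := pow_le_pow_right₀ (by linarith) (Nat.sub_le _ _)
  have h3 : |W (t - v) - W (t + v)| ≤ 2 * v * W (t - v) := by
    rw [abs_of_nonneg (sub_nonneg.2 (hanti (by linarith)))]
    refine (weight_sub_le_mul hW0 hmono (by linarith)).trans_eq ?_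
    ring
  have h4 : (t + v) ^ m ≤ (1 + t + v) ^ m := by gcongr; linarith
  have hW := hW0 (t - v)
  calc |(t - v) ^ m * W (t - v) - (t + v) ^ m * W (t + v)|
      = |((t - v) ^ m - (t + v) ^ m) * W (t - v) + (t + v) ^ m * (W (t - v) - W (t + v))| := by
        ring_nf
    _ ≤ |(t - v) ^ m - (t + v) ^ m| * W (t - v) + (t + v) ^ m * |W (t - v) - W (t + v)| := by
        refine (abs_add_le _ _).trans_eq ?_
        rw [abs_mul, abs_mul, abs_of_nonneg hW, abs_of_pos (a := (t + v) ^ m) (by positivity)]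
    _ ≤ 2 * v * m * (1 + t + v) ^ m * W (t - v) + (1 + t + v) ^ m * (2 * v * W (t - v)) := by
        gcongr
    _ = 2 * (m + 1) * v * (1 + t + v) ^ m * W (t - v) := by ring
    _ ≤ 2 * (m + 1) * v * (1 + t + v) ^ m * ((1 + t + v) * Real.exp (-((t - v) / 4))) := by
        gcongr
    _ = _ := by ring

end Weight

/-- The mean `∫₀¹ e^{su} du = (e^s - 1) / s` of the exponential. -/
noncomputable def expMean (s : ℝ) : ℝ := ∫ u in (0 : ℝ)..1, Real.exp (s * u)

lemma expMean_monotone : Monotone expMean := by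
  intro s t hst
  refine intervalIntegral.integral_mono_on zero_le_one
    (Continuous.intervalIntegrable (by fun_prop) _ _)
    (Continuous.intervalIntegrable (by fun_prop) _ _) fun u hu => ?_
  exact Real.exp_le_exp.2 (mul_le_mul_of_nonneg_right hst hu.1)

lemma exp_le_expMean {s : ℝ} (hs : s ≤ 0) : Real.exp s ≤ expMean s := by
  have := intervalIntegral.integral_mono_on (f := fun _ => Real.exp s)
    (g := fun u => Real.exp (s * u)) (μ := volume) zero_le_one
    (Continuous.intervalIntegrable (by fun_prop) _ _)
    (Continuous.intervalIntegrable (by fun_prop) _ _)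
    (fun u hu => Real.exp_le_exp.2 (by nlinarith [hu.1, hu.2]))
  simpa [expMean] using this

lemma expMean_pos (s : ℝ) : 0 < expMean s :=
  intervalIntegral.intervalIntegral_pos_of_pos (Continuous.intervalIntegrable (by fun_prop) _ _)
    (fun _ => Real.exp_pos _) zero_lt_one

lemma mul_expMean (s : ℝ) : s * expMean s = Real.exp s - 1 := by
  rw [expMean, intervalIntegral.mul_integral_comp_mul_left, integral_exp]
  simp

lemma exp_mul_expMean_neg (s : ℝ) : Real.exp s * expMean (-s) = expMean s := by
  have h := intervalIntegral.integral_comp_sub_left (fun u => Real.exp (s * u)) (1 : ℝ) (a := 0)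
    (b := 1)
  rw [sub_self, sub_zero] at h
  rw [expMean, expMean, ← h, ← intervalIntegral.integral_const_mul]
  congr 1; ext u
  rw [← Real.exp_add]; ring_nf

lemma exp_max_le_mul_expMean (s : ℝ) : Real.exp (max s 0) ≤ (1 + |s|) * expMean s := by
  have hneg : ∀ t : ℝ, t ≤ 0 → 1 ≤ (1 + |t|) * expMean t := by
    intro t ht
    have h1 := exp_le_expMean ht
    have h2 := mul_expMean t
    rw [abs_of_nonpos ht]
    linarith
  rcases le_total 0 s with h | h
  · rw [max_eq_left h, ← exp_mul_expMean_neg s]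
    have := hneg (-s) (by linarith)
    rw [abs_neg] at this
    nlinarith [Real.exp_pos s]
  · rw [max_eq_right h, Real.exp_zero]
    exact hneg s h

/-- For `a = -1`, and for `a = 1` and `q ≥ 2`, the function `s^(q-1) / (1 - a e^s)` extends over
`s = 0` to one that decays exponentially at `+∞`, grows polynomially at `-∞` and has increments
controlled in the same way. -/
lemma exists_weight {a : ℝ} {q : ℕ} (ha : a = 1 ∨ a = -1) (hq : 0 < q) (hqa : a = 1 → q ≠ 1) :
    ∃ (h : ℝ → ℝ) (C : ℝ) (N : ℕ), Measurable h ∧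
      (∀ s, s ≠ 0 → h s = s ^ (q - 1) / (1 - a * Real.exp s)) ∧
      (∀ s, |h s| ≤ C * (1 + |s|) ^ N * Real.exp (-max s 0)) ∧
      ∀ t v, 0 < t → 0 < v →
        |h (t - v) - h (t + v)| ≤ C * v * (1 + t + v) ^ N * Real.exp (-((t - v) / 4)) := by
  rcases ha with rfl | rfl
  -- for `a = 1` one factor `s` removes the pole: `s / (1 - e^s) = -1 / expMean s`
  · obtain ⟨m, rfl⟩ : ∃ m, q = m + 2 := ⟨q - 2, by have := hqa rfl; omega⟩
    have hW0 : ∀ s, 0 ≤ (expMean s)⁻¹ := fun s => (inv_pos.2 (expMean_pos s)).le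
    have hanti : Antitone fun s => (expMean s)⁻¹ :=
      fun x y hxy => inv_anti₀ (expMean_pos x) (expMean_monotone hxy)
    have hmono : Monotone fun s => Real.exp s * (expMean s)⁻¹ := by
      have : (fun s => Real.exp s * (expMean s)⁻¹) = fun s => (expMean (-s))⁻¹ := by
        ext s
        have h1 := expMean_pos (-s)
        rw [← exp_mul_expMean_neg s]
        have := Real.exp_pos s
        field_simp
      rw [this]
      exact fun x y hxy => hanti (neg_le_neg hxy)
    have hle : ∀ s, (expMean s)⁻¹ ≤ (1 + |s|) * Real.exp (-max s 0) := by
      intro s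
      have := exp_max_le_mul_expMean s
      rw [Real.exp_neg, inv_le_iff_one_le_mul₀ (expMean_pos s), mul_right_comm, ← div_eq_mul_inv,
        one_le_div (Real.exp_pos _)]
      exact this
    refine ⟨fun s => -(s ^ m * (expMean s)⁻¹), 2 * (m + 1), m + 1, ?_, ?_, ?_, ?_⟩
    · exact (Measurable.mul (by fun_prop) hanti.measurable).neg
    · intro s hs
      have h1 := mul_expMean s
      have h2 : 1 - 1 * Real.exp s = -(s * expMean s) := by linarith
      have := (expMean_pos s).ne'
      rw [h2, show m + 2 - 1 = m + 1 from rfl]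
      field_simp
      ring
    · intro s
      rw [abs_neg]
      exact abs_pow_mul_weight_le m hW0 hle s
    · intro t v ht hv
      rw [← neg_sub', abs_neg]
      exact abs_pow_mul_weight_sub_le m hW0 hanti hmono hle ht hv
  · obtain ⟨m, rfl⟩ : ∃ m, q = m + 1 := ⟨q - 1, by omega⟩
    have hW0 : ∀ s : ℝ, 0 ≤ (1 + Real.exp s)⁻¹ := fun s => by positivity
    have hanti : Antitone fun s => (1 + Real.exp s)⁻¹ := fun x y hxy => by
      simp only; gcongr
    have hmono : Monotone fun s => Real.exp s * (1 + Real.exp s)⁻¹ := by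
      have : (fun s => Real.exp s * (1 + Real.exp s)⁻¹) = fun s => (1 + Real.exp (-s))⁻¹ := by
        ext s
        rw [Real.exp_neg]
        have := Real.exp_pos s
        field_simp
        ring
      rw [this]
      intro x y hxy
      simp only; gcongr
    have hle : ∀ s, (1 + Real.exp s)⁻¹ ≤ (1 + |s|) * Real.exp (-max s 0) := by
      intro s
      have h1 : (1 + Real.exp s)⁻¹ ≤ Real.exp (-max s 0) := by
        rw [Real.exp_neg]
        gcongr
        rcases le_total 0 s with h | h
        · rw [max_eq_left h]; linarith
        · rw [max_eq_right h]; simp; positivity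
      refine h1.trans (le_mul_of_one_le_left (by positivity) ?_)
      linarith [abs_nonneg s]
    refine ⟨fun s => s ^ m * (1 + Real.exp s)⁻¹, 2 * (m + 1), m + 1, by fun_prop, ?_, ?_, ?_⟩
    · intro s _
      rw [div_eq_mul_inv]; simp
    · exact abs_pow_mul_weight_le m hW0 hle
    · intro t v ht hv
      exact abs_pow_mul_weight_sub_le m hW0 hanti hmono hle ht hv

/-! ### The polylogarithm as a symmetrized convolution -/

/-- `g(v) = β e^{-rv} / (1 - β e^{-rv})`: the kernel `β e^{rw} / (1 - β e^{rw})` at `w = -v`. Its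
value at `w = v` is `-1 - g(v)`. -/
noncomputable def polyLiKernel (β r v : ℝ) : ℝ := β * lerchKernel β r r v

@[fun_prop]
lemma measurable_polyLiKernel (β r : ℝ) : Measurable (polyLiKernel β r) := by
  unfold polyLiKernel; fun_prop

/-- The bound is `e^{-v} / (1 - e^{-v}) = e^{-v/2} / (2 sinh (v/2))` together with `x ≤ sinh x`. -/
lemma abs_polyLiKernel_le {β : ℝ} (hβ : β = 1 ∨ β = -1) {r v : ℝ} (hr : 1 ≤ r) (hv : 0 < v) :
    |polyLiKernel β r v| ≤ v⁻¹ * Real.exp (-(v / 2)) := by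
  have hrv : 0 < r * v := by positivity
  have h0 := one_sub_mul_exp_neg_pos hβ hrv
  have h1 : |β| = 1 := by rcases hβ with rfl | rfl <;> simp
  have hE := Real.exp_pos (-(r * v))
  have hE' := Real.exp_pos (-v)
  have hle : Real.exp (-(r * v)) ≤ Real.exp (-v) := Real.exp_le_exp.2 (by nlinarith)
  have hlt : Real.exp (-v) < 1 := by simpa using hv
  rw [polyLiKernel, lerchKernel, abs_mul, h1, one_mul, abs_div, abs_of_pos h0, abs_of_pos hE,
    div_le_iff₀ h0]
  have hs : Real.exp (-v) = Real.exp (-(v / 2)) * Real.exp (-(v / 2)) := by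
    rw [← Real.exp_add]; ring_nf
  have key : v * Real.exp (-(v / 2)) ≤ 1 - Real.exp (-v) := by
    have h2 : v ≤ 2 * Real.sinh (v / 2) := by
      have := Real.self_le_sinh_iff.2 (by linarith : 0 ≤ v / 2)
      linarith
    rw [Real.sinh_eq] at h2
    have h3 : Real.exp (v / 2) * Real.exp (-(v / 2)) = 1 := by rw [← Real.exp_add]; simp
    have := Real.exp_pos (-(v / 2))
    rw [hs]
    nlinarith
  have hstep : Real.exp (-(r * v)) * (1 - Real.exp (-v)) ≤
      Real.exp (-v) * (1 - β * Real.exp (-(r * v))) := by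
    rcases hβ with rfl | rfl
    · nlinarith
    · have : Real.exp (-(r * v)) * Real.exp (-v) ≥ 0 := by positivity
      nlinarith
  have hpos := Real.exp_pos (-(v / 2))
  have h5 : Real.exp (-(r * v)) * (v * Real.exp (-(v / 2))) ≤
      Real.exp (-v) * (1 - β * Real.exp (-(r * v))) :=
    (mul_le_mul_of_nonneg_left key hE.le).trans hstep
  rw [hs] at h5
  rw [mul_assoc, inv_mul_eq_div, le_div_iff₀ hv]
  have h6 : Real.exp (-(v / 2)) * (Real.exp (-(r * v)) * v) ≤
      Real.exp (-(v / 2)) * (Real.exp (-(v / 2)) * (1 - β * Real.exp (-(r * v)))) := by linarith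
  exact le_of_mul_le_mul_left h6 hpos

lemma abs_polyLiKernel_neg_one_le {v : ℝ} (hv : 0 < v) :
    |polyLiKernel (-1) 1 v| ≤ Real.exp (-(v / 2)) := by
  have h : Real.exp (-v) ≤ Real.exp (-(v / 2)) := Real.exp_le_exp.2 (by linarith)
  have := Real.exp_pos (-v)
  simp only [polyLiKernel, lerchKernel, one_mul, neg_mul, sub_neg_eq_add, abs_neg]
  rw [abs_div, abs_of_pos this, abs_of_pos (by linarith)]
  exact (div_le_self this.le (by linarith)).trans h

/-- The integrand of `Li_{m+1}(β e^S)` after the substitution `y = e^{w - S}`. -/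
noncomputable def polyLiIntegrand (m : ℕ) (β S w : ℝ) : ℝ :=
  truncPow m (S - w) * (β * Real.exp w / (1 - β * Real.exp w))

@[fun_prop]
lemma measurable_polyLiIntegrand (m : ℕ) (β S : ℝ) : Measurable (polyLiIntegrand m β S) := by
  unfold polyLiIntegrand; fun_prop

lemma polyLiIntegrand_neg (m : ℕ) (β S v : ℝ) :
    polyLiIntegrand m β S (-v) = polyLiKernel β 1 v * truncPow m (S + v) := by
  simp only [polyLiIntegrand, polyLiKernel, lerchKernel, sub_neg_eq_add, one_mul]
  ring

lemma mul_exp_div_one_sub_mul_exp {β : ℝ} (hβ : β = 1 ∨ β = -1) {x : ℝ} (hx : 0 < x) :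
    β * Real.exp x / (1 - β * Real.exp x) =
      -1 - β * (Real.exp (-x) / (1 - β * Real.exp (-x))) := by
  have h0 := one_sub_mul_exp_neg_pos hβ hx
  have h1 : 1 - β * Real.exp x ≠ 0 := by
    have : 1 < Real.exp x := by simpa using hx
    rcases hβ with rfl | rfl <;> linarith
  have h2 : Real.exp (-x) * Real.exp x = 1 := by rw [← Real.exp_add]; simp
  have h3 : β * β = 1 := by rcases hβ with rfl | rfl <;> norm_num
  have h4 : -1 - β * (Real.exp (-x) / (1 - β * Real.exp (-x))) = -1 / (1 - β * Real.exp (-x)) := by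
    field_simp; ring
  rw [h4, div_eq_div_iff h1 h0.ne']
  linear_combination (-β * β) * h2 - h3

lemma polyLiIntegrand_of_pos (m : ℕ) {β : ℝ} (hβ : β = 1 ∨ β = -1) (S : ℝ) {v : ℝ} (hv : 0 < v) :
    polyLiIntegrand m β S v = (-1 - polyLiKernel β 1 v) * truncPow m (S - v) := by
  rw [polyLiIntegrand, mul_exp_div_one_sub_mul_exp hβ hv, mul_comm]
  simp only [polyLiKernel, lerchKernel, one_mul]

/-- The substitution `y = e^{w - S}`, on a subset of `(0, 1)` given by a predicate `P`. -/
lemma setIntegral_polyLi_integrand {m : ℕ} {β S : ℝ} (P : ℝ → Prop)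
    (hP : MeasurableSet {w | P (Real.exp (w - S))}) :
    (-1) ^ m * ∫ y in {y | y ∈ Ioo (0 : ℝ) 1 ∧ P y},
      β * Real.exp S * Real.log y ^ m / (1 - β * Real.exp S * y) =
    ∫ w in {w | P (Real.exp (w - S))}, polyLiIntegrand m β S w := by
  set B : Set ℝ := {w | w < S} ∩ {w | P (Real.exp (w - S))} with hB
  have himg : {y | y ∈ Ioo (0 : ℝ) 1 ∧ P y} = (fun w => Real.exp (w - S)) '' B := by
    ext y
    constructor
    · rintro ⟨hy, hPy⟩
      have : Real.exp (Real.log y + S - S) = y := by simp [Real.exp_log hy.1]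
      refine ⟨Real.log y + S, ⟨?_, ?_⟩, this⟩
      · have := Real.log_neg hy.1 hy.2
        simp only [mem_ofPred_eq]; linarith
      · simp only [mem_ofPred_eq]; rwa [this]
    · rintro ⟨w, ⟨hw, hPw⟩, rfl⟩
      have hw : w < S := hw
      exact ⟨⟨Real.exp_pos _, by simpa using hw⟩, hPw⟩
  have hBm : MeasurableSet B := measurableSet_Iio.inter hP
  rw [himg, integral_image_eq_integral_abs_deriv_smul hBm
    (f' := fun w => Real.exp (w - S))
    (fun w _ => by simpa using (((hasDerivAt_id w).sub_const S).exp).hasDerivWithinAt)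
    (fun x _ y _ hxy => by simpa using hxy), ← integral_const_mul]
  have hz : ∫ w in {w | P (Real.exp (w - S))}, polyLiIntegrand m β S w =
      ∫ w in B, polyLiIntegrand m β S w := by
    refine setIntegral_eq_of_subset_of_forall_sdiff_eq_zero (μ := volume)
      (f := polyLiIntegrand m β S) hP inter_subset_right ?_
    rintro w ⟨hw, hwB⟩
    have : S ≤ w := by
      by_contra h
      exact hwB ⟨not_le.1 h, hw⟩
    rw [polyLiIntegrand, truncPow_of_nonpos (by linarith), zero_mul]
  rw [hz]
  refine setIntegral_congr_fun hBm fun w hw => ?_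
  have hw : w < S := hw.1
  have h1 : Real.exp S * Real.exp (w - S) = Real.exp w := by rw [← Real.exp_add]; ring_nf
  simp only [smul_eq_mul, abs_of_pos (Real.exp_pos _), Real.log_exp, polyLiIntegrand]
  rw [truncPow_of_pos (by linarith), mul_assoc β _ (Real.exp (w - S)), h1, ← neg_sub w S,
    neg_pow (w - S), ← h1]
  ring

lemma integrableOn_truncPow_sub (m : ℕ) (S : ℝ) {η : ℝ} (hη : 0 ≤ η) :
    IntegrableOn (fun v => truncPow m (S - v)) (Ioi η) := by
  have he : IntegrableOn (fun v : ℝ => Real.exp (-(1 * v))) (Ioi η) := by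
    have := integrableOn_pow_mul_exp_neg 0 one_pos
    simp only [pow_zero, one_mul] at this ⊢
    exact this.mono_set (Ioi_subset_Ioi hη)
  refine (he.const_mul (|S| ^ m * Real.exp |S|)).mono'
    (Measurable.aestronglyMeasurable (by fun_prop)) ?_
  filter_upwards [ae_restrict_mem measurableSet_Ioi] with v hv
  have hv : 0 < v := hη.trans_lt hv
  rw [Real.norm_of_nonneg (truncPow_nonneg _ _)]
  rcases le_or_gt (S - v) 0 with h | h
  · rw [truncPow_of_nonpos h]; positivity
  · have h1 : truncPow m (S - v) ≤ |S| ^ m :=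
      truncPow_le (by linarith [le_abs_self S]) (abs_nonneg S)
    have h2 : 1 ≤ Real.exp |S| * Real.exp (-(1 * v)) := by
      rw [← Real.exp_add]; apply Real.one_le_exp; linarith [le_abs_self S]
    calc truncPow m (S - v) ≤ |S| ^ m * 1 := by rwa [mul_one]
      _ ≤ |S| ^ m * (Real.exp |S| * Real.exp (-(1 * v))) := by gcongr
      _ = _ := by ring

/-- The two halves of the symmetrized integrand of a polylogarithm. -/
lemma integrableOn_polyLiKernel_mul_truncPow (m : ℕ) {β S η κ : ℝ} (hη : 0 ≤ η)
    (h1 : ∀ v, η < v → |polyLiKernel β 1 v| * truncPow m (S + v) ≤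
      κ * Real.exp (-(v / 2)) * truncPow m (S + v))
    (h2 : ∀ v, η < v → |polyLiKernel β 1 v| * truncPow m (S - v) ≤ κ * truncPow m (S - v)) :
    IntegrableOn (fun v => polyLiKernel β 1 v * truncPow m (S + v)) (Ioi η) ∧
    IntegrableOn (fun v => (-1 - polyLiKernel β 1 v) * truncPow m (S - v)) (Ioi η) := by
  constructor
  · refine ((integrable_decayBound (m + 1)).integrableOn.const_mul (|κ| * (1 + |S|) ^ m)).mono'
      (Measurable.aestronglyMeasurable (by fun_prop)) ?_
    filter_upwards [ae_restrict_mem measurableSet_Ioi] with v hv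
    have hv0 : 0 < v := hη.trans_lt hv
    rw [norm_mul, Real.norm_eq_abs, Real.norm_of_nonneg (truncPow_nonneg _ _)]
    have h3 : truncPow m (S + v) ≤ (1 + |S|) ^ m * (1 + |v|) ^ m :=
      (truncPow_le (by linarith [le_abs_self S, le_abs_self v]) (by positivity)).trans
        (add_pow_le_one_add_pow_mul (abs_nonneg S) (abs_nonneg v) m)
    calc |polyLiKernel β 1 v| * truncPow m (S + v)
        ≤ κ * Real.exp (-(v / 2)) * truncPow m (S + v) := h1 v hv
      _ ≤ |κ| * Real.exp (-(|v| / 4)) * ((1 + |S|) ^ m * (1 + |v|) ^ m) := by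
          have h4 : Real.exp (-(v / 2)) ≤ Real.exp (-(|v| / 4)) := by
            rw [Real.exp_le_exp, abs_of_pos hv0]; linarith
          have h5 := mul_le_mul (le_abs_self κ) h4 (Real.exp_pos _).le (abs_nonneg κ)
          exact mul_le_mul h5 h3 (truncPow_nonneg _ _) (by positivity)
      _ = |κ| * (1 + |S|) ^ m * ((1 + |v|) ^ m * Real.exp (-(|v| / 4))) := by ring
      _ ≤ _ := by gcongr; exact exp_le_decayBound hv0.ne'
  · refine ((integrableOn_truncPow_sub m S hη).const_mul (1 + κ)).mono'
      (Measurable.aestronglyMeasurable (by fun_prop)) ?_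
    filter_upwards [ae_restrict_mem measurableSet_Ioi] with v hv
    rw [norm_mul, Real.norm_eq_abs, Real.norm_of_nonneg (truncPow_nonneg _ _), add_mul]
    have h3 : |-1 - polyLiKernel β 1 v| ≤ 1 + |polyLiKernel β 1 v| := by
      refine (abs_sub _ _).trans ?_
      simp
    have := mul_le_mul_of_nonneg_right h3 (truncPow_nonneg m (S - v))
    linarith [h2 v hv]

/-- The symmetrized integrand of `Li_{m+1}(β e^S)`. -/
noncomputable def polyLiSymm (m : ℕ) (β S v : ℝ) : ℝ :=
  polyLiKernel β 1 v * truncPow m (S + v) + (-1 - polyLiKernel β 1 v) * truncPow m (S - v)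

lemma integrableOn_polyLiSymm (m : ℕ) {β S : ℝ} (hβ : β = 1 ∨ β = -1) (hS : S ≠ 0) :
    IntegrableOn (polyLiSymm m β S) (Ioi 0) := by
  have hS0 : 0 < |S| := abs_pos.2 hS
  have h1 : IntegrableOn (fun v => polyLiKernel β 1 v *
      (truncPow m (S + v) - truncPow m (S - v))) (Ioi 0) := by
    refine ((integrable_decayBound m).integrableOn.const_mul
      (2 * (m + 1) * (1 + |S|) ^ m * (√|S|)⁻¹)).mono'
      (Measurable.aestronglyMeasurable (by fun_prop)) ?_
    filter_upwards [ae_restrict_mem measurableSet_Ioi] with v hv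
    have hv : 0 < v := hv
    have h6 : v⁻¹ * √v = (√v)⁻¹ := by
      have : √v ≠ 0 := (Real.sqrt_pos.2 hv).ne'
      field_simp
      exact Real.sq_sqrt hv.le
    rw [norm_mul, Real.norm_eq_abs, Real.norm_eq_abs]
    calc _ ≤ (v⁻¹ * Real.exp (-(v / 2))) * (2 * (m + 1) * ((1 + |S|) ^ m * (1 + v) ^ m) *
              (√v * (√|S|)⁻¹)) := by
            gcongr
            · exact abs_polyLiKernel_le hβ le_rfl hv
            · exact (abs_truncPow_add_sub_truncPow_sub_le m hS hv).trans
                (by gcongr; exact add_pow_le_one_add_pow_mul hS0.le hv.le m)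
      _ ≤ (v⁻¹ * Real.exp (-(v / 4))) * (2 * (m + 1) * ((1 + |S|) ^ m * (1 + v) ^ m) *
              (√v * (√|S|)⁻¹)) := by gcongr; norm_num
      _ = 2 * (m + 1) * (1 + |S|) ^ m * (√|S|)⁻¹ * ((1 + v) ^ m * (v⁻¹ * √v) *
            Real.exp (-(v / 4))) := by ring
      _ = _ := by rw [h6, decayBound, abs_of_pos hv]
  refine (h1.sub (integrableOn_truncPow_sub m S le_rfl)).congr (ae_of_all _ fun v => ?_)
  simp only [Pi.sub_apply, polyLiSymm]; ring

/-- Without a cut, when the integrand has no pole on the range of integration. -/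
lemma integral_polyLiIntegrand_of_bound (m : ℕ) {β S κ : ℝ} (hβ : β = 1 ∨ β = -1)
    (h1 : ∀ v, 0 < v → |polyLiKernel β 1 v| * truncPow m (S + v) ≤
      κ * Real.exp (-(v / 2)) * truncPow m (S + v))
    (h2 : ∀ v, 0 < v → |polyLiKernel β 1 v| * truncPow m (S - v) ≤ κ * truncPow m (S - v)) :
    ∫ w, polyLiIntegrand m β S w = ∫ v in Ioi (0 : ℝ), polyLiSymm m β S v := by
  obtain ⟨i1, i2⟩ := integrableOn_polyLiKernel_mul_truncPow m le_rfl h1 h2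
  have hIoi : IntegrableOn (polyLiIntegrand m β S) (Ioi 0) :=
    i2.congr_fun (fun v hv => (polyLiIntegrand_of_pos m hβ S hv).symm) measurableSet_Ioi
  have hneg : IntegrableOn (fun v => polyLiIntegrand m β S (-v)) (Ioi 0) := by
    simpa only [polyLiIntegrand_neg] using i1
  have hIio : IntegrableOn (polyLiIntegrand m β S) (Iio 0) := by
    rw [← neg_zero] at hneg
    simpa using hneg.comp_neg_Iio
  rw [← intervalIntegral.integral_Iic_add_Ioi
    ((integrableOn_Iic_iff_integrableOn_Iio (by simp)).2 hIio) hIoi]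
  have e1 := integral_comp_neg_Ioi 0 (polyLiIntegrand m β S)
  rw [neg_zero] at e1
  have e2 : ∫ v in Ioi (0 : ℝ), polyLiIntegrand m β S v =
      ∫ v in Ioi (0 : ℝ), (-1 - polyLiKernel β 1 v) * truncPow m (S - v) :=
    setIntegral_congr_fun measurableSet_Ioi fun v hv => polyLiIntegrand_of_pos m hβ S hv
  rw [← e1, e2]
  simp only [polyLiIntegrand_neg, polyLiSymm]
  exact (integral_add i1 i2).symm

lemma tendsto_setIntegral_Ioi_zero {G : ℝ → ℝ} (hG : IntegrableOn G (Ioi 0)) {l : Filter ℝ}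
    [l.IsCountablyGenerated] {η : ℝ → ℝ} (hη : Tendsto η l (𝓝 0)) (h0 : ∀ᶠ ε in l, 0 ≤ η ε) :
    Tendsto (fun ε => ∫ v in Ioi (η ε), G v) l (𝓝 (∫ v in Ioi (0 : ℝ), G v)) := by
  have h := tendsto_integral_filter_of_dominated_convergence (l := l)
    (μ := volume.restrict (Ioi (0 : ℝ))) (F := fun ε v => (Ioi (η ε)).indicator G v) (f := G)
    (fun v => ‖G v‖) ?_ ?_ hG.norm ?_
  · refine h.congr' ?_
    filter_upwards [h0] with ε hε
    rw [integral_indicator measurableSet_Ioi,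
      Measure.restrict_restrict_of_subset (Ioi_subset_Ioi hε)]
  · exact Eventually.of_forall fun ε => hG.aestronglyMeasurable.indicator measurableSet_Ioi
  · exact Eventually.of_forall fun ε => ae_of_all _ fun v => norm_indicator_le_norm_self _ _
  · filter_upwards [ae_restrict_mem measurableSet_Ioi] with v hv
    refine tendsto_const_nhds.congr' ?_
    filter_upwards [hη.eventually (gt_mem_nhds hv)] with ε hε
    exact (indicator_of_mem (show v ∈ Ioi (η ε) from hε) G).symm

/-- A window that is symmetric in `y` around the pole is `(log (1 - δ), log (1 + δ))` in the
variable `w`; its asymmetry contributes nothing in the limit. -/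
lemma tendsto_integral_polyLiIntegrand_cut (m : ℕ) {S : ℝ} (hS : 0 < S) :
    Tendsto (fun δ => ∫ w in {w | δ < |Real.exp w - 1|}, polyLiIntegrand m 1 S w) (𝓝[>] 0)
      (𝓝 (∫ v in Ioi (0 : ℝ), polyLiSymm m 1 S v)) := by
  have hη0 : Tendsto (fun δ : ℝ => Real.log (1 + δ)) (𝓝[>] 0) (𝓝 0) := by
    have : ContinuousAt (fun δ : ℝ => Real.log (1 + δ)) 0 := by
      apply ContinuousAt.log (by fun_prop) (by simp)
    simpa [ContinuousAt] using this.tendsto.mono_left (nhdsWithin_le_nhds (s := Ioi 0))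
  have hA := tendsto_setIntegral_Ioi_zero (integrableOn_polyLiSymm m (Or.inl rfl) hS.ne') hη0
    (by filter_upwards [self_mem_nhdsWithin] with δ hδ
        exact Real.log_nonneg (by linarith [show (0 : ℝ) < δ from hδ]))
  have hsmall : ∀ᶠ δ in 𝓝[>] (0 : ℝ), 0 < δ ∧ δ < 1 / 2 :=
    Ioo_mem_nhdsGT (by norm_num)
  have hE : Tendsto (fun δ : ℝ => ∫ v in Ioc (Real.log (1 + δ)) (-Real.log (1 - δ)),
      polyLiIntegrand m 1 S (-v)) (𝓝[>] 0) (𝓝 0) := by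
    have hb : Tendsto (fun δ : ℝ => 4 * (S + 1) ^ m * δ) (𝓝[>] 0) (𝓝 0) := by
      have : Continuous fun δ : ℝ => 4 * (S + 1) ^ m * δ := by fun_prop
      simpa using (this.tendsto 0).mono_left (nhdsWithin_le_nhds (s := Ioi 0))
    refine squeeze_zero_norm' ?_ hb
    filter_upwards [hsmall] with δ hδ
    obtain ⟨h0, h1⟩ := hδ
    have hl1 : δ / 2 ≤ Real.log (1 + δ) := by
      refine le_trans ?_ (Real.one_sub_inv_le_log_of_pos (by linarith))
      rw [show 1 - (1 + δ)⁻¹ = δ / (1 + δ) by field_simp; ring]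
      gcongr; linarith
    have hl2 : -Real.log (1 - δ) ≤ 1 := by
      have := Real.one_sub_inv_le_log_of_pos (show 0 < 1 - δ by linarith)
      have h3 : (1 - δ)⁻¹ ≤ 2 := by
        rw [inv_le_comm₀ (by linarith) (by norm_num)]; linarith
      linarith
    have hl3 : -Real.log (1 - δ) - Real.log (1 + δ) ≤ 2 * δ ^ 2 := by
      have h3 : -Real.log (1 - δ) - Real.log (1 + δ) = -Real.log (1 - δ ^ 2) := by
        rw [show 1 - δ ^ 2 = (1 - δ) * (1 + δ) by ring,
          Real.log_mul (by linarith) (by linarith)]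
        ring
      have h5 : 0 < 1 - δ ^ 2 := by nlinarith
      have h4 := Real.one_sub_inv_le_log_of_pos h5
      have h6 : (1 - δ ^ 2)⁻¹ ≤ 1 + 2 * δ ^ 2 := by
        rw [inv_le_iff_one_le_mul₀ h5]
        have h7 : δ ^ 2 ≤ 1 / 4 := by nlinarith
        nlinarith [mul_nonneg (sq_nonneg δ) (sub_nonneg.2 h7)]
      linarith
    have hbound : ∀ v ∈ Ioc (Real.log (1 + δ)) (-Real.log (1 - δ)),
        ‖polyLiIntegrand m 1 S (-v)‖ ≤ (δ / 2)⁻¹ * (S + 1) ^ m := by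
      intro v hv
      have hv0 : δ / 2 < v := hl1.trans_lt hv.1
      have hvp : 0 < v := by linarith
      rw [polyLiIntegrand_neg, norm_mul, Real.norm_of_nonneg (truncPow_nonneg _ _)]
      gcongr
      · exact truncPow_nonneg _ _
      · refine (abs_polyLiKernel_le (Or.inl rfl) le_rfl hvp).trans ?_
        refine (mul_le_of_le_one_right (by positivity) ?_).trans (by gcongr)
        simp; linarith
      · exact truncPow_le (by linarith [hv.2]) (by linarith)
    refine (norm_setIntegral_le_of_norm_le_const (by simp) hbound).trans ?_
    rcases le_total (Real.log (1 + δ)) (-Real.log (1 - δ)) with hle | hle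
    · rw [Real.volume_real_Ioc_of_le hle]
      calc (δ / 2)⁻¹ * (S + 1) ^ m * (-Real.log (1 - δ) - Real.log (1 + δ))
          ≤ (δ / 2)⁻¹ * (S + 1) ^ m * (2 * δ ^ 2) := by gcongr
        _ = _ := by field_simp; ring
    · rw [Ioc_eq_empty (not_lt.2 hle)]
      simp; positivity
  have hlim := hA.sub hE
  rw [sub_zero] at hlim
  refine hlim.congr' ?_
  filter_upwards [hsmall] with δ hδ
  obtain ⟨h0, h1⟩ := hδ
  set η := Real.log (1 + δ) with hη
  set η' := -Real.log (1 - δ) with hη'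
  have hηpos : 0 < η := Real.log_pos (by linarith)
  have hηη' : η ≤ η' := by
    have h3 : η' - η = -Real.log (1 - δ ^ 2) := by
      rw [show 1 - δ ^ 2 = (1 - δ) * (1 + δ) by ring,
        Real.log_mul (by linarith) (by linarith)]
      ring
    have := Real.log_nonpos (show 0 ≤ 1 - δ ^ 2 by nlinarith) (by nlinarith)
    linarith
  have hset : {w | δ < |Real.exp w - 1|} = Iio (-η') ∪ Ioi η := by
    ext w
    simp only [mem_ofPred_eq, mem_union, mem_Iio, mem_Ioi, lt_abs, hη, hη', neg_neg]
    rw [Real.log_lt_iff_lt_exp (by linarith), Real.lt_log_iff_exp_lt (by linarith), or_comm]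
    constructor <;> rintro (h | h)
    · left; linarith
    · right; linarith
    · left; linarith
    · right; linarith
  have hk : ∀ v, η < v → |polyLiKernel 1 1 v| ≤ η⁻¹ * Real.exp (-(v / 2)) := fun v hv =>
    (abs_polyLiKernel_le (Or.inl rfl) le_rfl (hηpos.trans hv)).trans (by gcongr)
  obtain ⟨i1, i2⟩ := integrableOn_polyLiKernel_mul_truncPow (β := 1) (S := S) (κ := η⁻¹) m hηpos.le
    (fun v hv => mul_le_mul_of_nonneg_right (hk v hv) (truncPow_nonneg _ _))
    (fun v hv => mul_le_mul_of_nonneg_right ((hk v hv).trans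
      (mul_le_of_le_one_right (by positivity) (by simp; linarith))) (truncPow_nonneg _ _))
  have hIoi : IntegrableOn (polyLiIntegrand m 1 S) (Ioi η) :=
    i2.congr_fun (fun v hv => (polyLiIntegrand_of_pos m (Or.inl rfl) S (hηpos.trans hv)).symm)
      measurableSet_Ioi
  have hneg : IntegrableOn (fun v => polyLiIntegrand m 1 S (-v)) (Ioi η) := by
    simpa only [polyLiIntegrand_neg] using i1
  have hneg' := hneg.mono_set (Ioi_subset_Ioi hηη')
  have hIio : IntegrableOn (polyLiIntegrand m 1 S) (Iio (-η')) := by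
    rw [← neg_neg η'] at hneg'
    simpa using hneg'.comp_neg_Iio
  rw [hset, setIntegral_union ((Iio_disjoint_Ioi_of_le (by linarith))) measurableSet_Ioi hIio hIoi,
    ← integral_Iic_eq_integral_Iio, ← integral_comp_neg_Ioi]
  have hsplit : ∫ v in Ioi η, polyLiIntegrand m 1 S (-v) =
      (∫ v in Ioc η η', polyLiIntegrand m 1 S (-v)) +
        ∫ v in Ioi η', polyLiIntegrand m 1 S (-v) := by
    rw [← setIntegral_union (Ioc_disjoint_Ioi le_rfl) measurableSet_Ioi
      (hneg.mono_set Ioc_subset_Ioi_self) hneg', Ioc_union_Ioi_eq_Ioi hηη']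
  have hG : ∫ v in Ioi η, polyLiSymm m 1 S v =
      (∫ v in Ioi η, polyLiIntegrand m 1 S (-v)) + ∫ v in Ioi η, polyLiIntegrand m 1 S v := by
    rw [← integral_add hneg hIoi]
    refine setIntegral_congr_fun measurableSet_Ioi fun v hv => ?_
    simp only [polyLiIntegrand_neg, polyLiSymm,
      polyLiIntegrand_of_pos m (Or.inl rfl) S (hηpos.trans hv)]
  rw [hG, hsplit]
  ring

/-- The convolution formula for a single exponential. The pole at `y = e^{-S}` lies in `(0, 1)` only
for `β = 1` and `S > 0`. -/
lemma polyLi_mul_exp (m : ℕ) {β S : ℝ} (hβ : β = 1 ∨ β = -1) (hS : S ≠ 0) :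
    polyLi (m + 1) (β * Real.exp S) =
      (m.factorial : ℝ)⁻¹ * ∫ v in Ioi (0 : ℝ), polyLiSymm m β S v := by
  have hreg : ∀ κ : ℝ, β * Real.exp S ≤ 1 →
      (∀ v, 0 < v → |polyLiKernel β 1 v| * truncPow m (S + v) ≤
        κ * Real.exp (-(v / 2)) * truncPow m (S + v)) →
      (∀ v, 0 < v → |polyLiKernel β 1 v| * truncPow m (S - v) ≤ κ * truncPow m (S - v)) →
      polyLi (m + 1) (β * Real.exp S) =
        (m.factorial : ℝ)⁻¹ * ∫ v in Ioi (0 : ℝ), polyLiSymm m β S v := by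
    intro κ hle h1 h2
    have h := setIntegral_polyLi_integrand (m := m) (β := β) (S := S) (fun _ => True) (by simp)
    simp only [and_true, ofPred_mem_eq, ofPred_true, Measure.restrict_univ] at h
    rw [polyLi, if_pos hle, Nat.add_sub_cancel, ← integral_polyLiIntegrand_of_bound m hβ h1 h2, ← h]
    ring
  rcases hβ with rfl | rfl
  · rcases lt_or_gt_of_ne hS with hneg | hpos
    · have hS0 : 0 < -S := by linarith
      refine hreg (-S)⁻¹ (by simpa using hneg.le) (fun v hv => ?_) (fun v hv => ?_)
      · rcases le_or_gt (S + v) 0 with h | h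
        · rw [truncPow_of_nonpos h]; simp
        · gcongr
          · exact truncPow_nonneg _ _
          · exact (abs_polyLiKernel_le (Or.inl rfl) le_rfl hv).trans (by gcongr; linarith)
      · rw [truncPow_of_nonpos (by linarith)]; simp
    · have hx : 1 < Real.exp S := by simpa using hpos
      have hcut : Tendsto (fun ε => (-1) ^ m * ∫ y in {y | y ∈ Ioo (0 : ℝ) 1 ∧
          ε < |y - (Real.exp S)⁻¹|}, Real.exp S * Real.log y ^ m / (1 - Real.exp S * y))
          (𝓝[>] 0) (𝓝 (∫ v in Ioi (0 : ℝ), polyLiSymm m 1 S v)) := by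
        have hδ : Tendsto (fun ε : ℝ => ε * Real.exp S) (𝓝[>] 0) (𝓝[>] 0) := by
          refine tendsto_nhdsWithin_iff.2 ⟨?_, ?_⟩
          · have : Continuous fun ε : ℝ => ε * Real.exp S := by fun_prop
            simpa using (this.tendsto 0).mono_left (nhdsWithin_le_nhds (s := Ioi 0))
          · filter_upwards [self_mem_nhdsWithin] with ε hε
            exact mul_pos hε (Real.exp_pos S)
        refine ((tendsto_integral_polyLiIntegrand_cut m hpos).comp hδ).congr fun ε => ?_
        have h := setIntegral_polyLi_integrand (m := m) (β := 1) (S := S)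
          (fun y => ε < |y - (Real.exp S)⁻¹|)
          (measurableSet_lt measurable_const (by fun_prop))
        simp only [one_mul] at h
        rw [h]
        simp only [Function.comp_apply]
        congr 2
        ext w
        have h1 : Real.exp w - 1 = (Real.exp (w - S) - (Real.exp S)⁻¹) * Real.exp S := by
          rw [sub_mul, inv_mul_cancel₀ (Real.exp_pos S).ne', ← Real.exp_add]; ring_nf
        simp only [mem_ofPred_eq]
        rw [h1, abs_mul, abs_of_pos (Real.exp_pos S), mul_lt_mul_iff_left₀ (Real.exp_pos S)]
      have hcut' := hcut.const_mul ((-1 : ℝ) ^ m)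
      have hsq : ((-1 : ℝ) ^ m) * (-1) ^ m = 1 := by rw [← mul_pow]; simp
      simp only [← mul_assoc, hsq, one_mul] at hcut'
      rw [polyLi, one_mul, if_neg (not_le.2 hx), Nat.add_sub_cancel, cauchyPV, hcut'.limUnder_eq]
      linear_combination ((m.factorial : ℝ)⁻¹ * ∫ v in Ioi (0 : ℝ), polyLiSymm m 1 S v) * hsq
  · refine hreg 1 (by linarith [Real.exp_pos S]) (fun v hv => ?_) (fun v hv => ?_)
    · rw [one_mul]
      exact mul_le_mul_of_nonneg_right (abs_polyLiKernel_neg_one_le hv) (truncPow_nonneg _ _)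
    · refine mul_le_mul_of_nonneg_right ((abs_polyLiKernel_neg_one_le hv).trans ?_)
        (truncPow_nonneg _ _)
      simp; linarith

/-- `Li_{m+1}(β e^{ns})` as a convolution of `t₊^m` with a kernel that has a simple pole at `0`
when `β = 1`; adding the values of the integrand at `v` and `-v` accounts for the principal
value. -/
lemma polyLi_mul_exp_pow (m : ℕ) {n : ℕ} (hn : 0 < n) {β s : ℝ} (hβ : β = 1 ∨ β = -1)
    (hs : s ≠ 0) :
    polyLi (m + 1) (β * Real.exp s ^ n) = (n : ℝ) ^ (m + 1) * (m.factorial : ℝ)⁻¹ *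
      ∫ v in Ioi (0 : ℝ), (polyLiKernel β n v * truncPow m (s + v) +
        (-1 - polyLiKernel β n v) * truncPow m (s - v)) := by
  have hn' : (0 : ℝ) < n := by exact_mod_cast hn
  rw [← Real.exp_nat_mul, polyLi_mul_exp m hβ (by positivity)]
  have h := integral_comp_mul_left_Ioi (polyLiSymm m β (n * s)) 0 hn'
  rw [mul_zero, smul_eq_mul] at h
  have hf : ∀ t : ℝ, truncPow m (n * t) = (n : ℝ) ^ m * truncPow m t := by
    intro t
    simp only [truncPow, mul_pos_iff_of_pos_left hn']
    split_ifs <;> ring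
  have hG : ∀ v, polyLiSymm m β (n * s) (n * v) = (n : ℝ) ^ m *
      (polyLiKernel β n v * truncPow m (s + v) +
        (-1 - polyLiKernel β n v) * truncPow m (s - v)) := by
    intro v
    have hg : polyLiKernel β 1 (n * v) = polyLiKernel β n v := by
      simp [polyLiKernel, lerchKernel]
    rw [polyLiSymm, hg, ← mul_add, ← mul_sub, hf, hf]
    ring
  simp_rw [hG, integral_const_mul] at h
  rw [eq_inv_mul_iff_mul_eq₀ hn'.ne'] at h
  rw [← h]
  ring

/-! ### Evaluation of the inner integral by partial fractions -/

/-- Partial fractions in `X`, with `X = e^s`, `Y = e^{-nt}`, of the product of the kernel and the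
weight. -/
lemma pow_mul_div_eq_partialFractions {a b : ℝ} (ha : a = 1 ∨ a = -1) (n : ℕ) {X Y : ℝ}
    (h1 : 1 - a * X ≠ 0) (h2 : 1 - b * (Y * X ^ (n + 1)) ≠ 0) (h3 : 1 - a ^ (n + 1) * b * Y ≠ 0) :
    b * (Y * X ^ (n + 1)) / (1 - b * (Y * X ^ (n + 1))) / (1 - a * X) =
      b * a ^ n * (Y / (1 - a ^ (n + 1) * b * Y)) *
        (a * (a * X / (1 - a * X) - b * (Y * X ^ (n + 1)) / (1 - b * (Y * X ^ (n + 1)))) -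
          ∑ i ∈ Finset.range n, a ^ i * (X ^ (i + 1) / (1 - b * (Y * X ^ (n + 1))))) := by
  have haa : a * a = 1 := by rcases ha with rfl | rfl <;> norm_num
  have han : a ^ n * a ^ n = 1 := by rw [← mul_pow, haa, one_pow]
  have hgeom : (∑ i ∈ Finset.range n, a ^ i * X ^ (i + 1)) * (1 - a * X) =
      X * (1 - a ^ n * X ^ n) := by
    have := geom_sum_mul (a * X) n
    have h4 : ∑ i ∈ Finset.range n, a ^ i * X ^ (i + 1) =
        X * ∑ i ∈ Finset.range n, (a * X) ^ i := by
      rw [Finset.mul_sum]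
      exact Finset.sum_congr rfl fun i _ => by rw [mul_pow]; ring
    rw [h4, ← mul_pow]
    linear_combination -X * this
  have hsum : ∑ i ∈ Finset.range n, a ^ i * (X ^ (i + 1) / (1 - b * (Y * X ^ (n + 1)))) =
      (∑ i ∈ Finset.range n, a ^ i * X ^ (i + 1)) / (1 - b * (Y * X ^ (n + 1))) := by
    rw [Finset.sum_div]
    exact Finset.sum_congr rfl fun i _ => by ring
  have hS : ∑ i ∈ Finset.range n, a ^ i * X ^ (i + 1) =
      X * (1 - a ^ n * X ^ n) / (1 - a * X) := by rw [← hgeom]; field_simp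
  rw [hsum, hS]
  have key : b * Y * X ^ (n + 1) * (1 - a ^ (n + 1) * b * Y) = b * a ^ n * Y *
      (a * (a * X * (1 - b * (Y * X ^ (n + 1))) - b * (Y * X ^ (n + 1)) * (1 - a * X)) -
        X * (1 - a ^ n * X ^ n)) := by
    rw [pow_succ a n, pow_succ X n]
    linear_combination (-b * Y * X ^ n * X) * han - b * a ^ n * Y * X * haa
  generalize 1 - b * (Y * X ^ (n + 1)) = D2 at *
  generalize 1 - a * X = D1 at *
  generalize 1 - a ^ (n + 1) * b * Y = D3 at *
  generalize X ^ (n + 1) = Z at *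
  field_simp
  linear_combination key

section InnerIntegral

variable {b : ℝ} {n : ℕ}

/-- The moments of order `k` that combine into `Θ(b, k + 1, i, n)`. The two terms are integrable
only jointly when `b = 1` and `k = 0`. -/
lemma integral_theta_moment (hb : b = 1 ∨ b = -1) {i : ℕ} (hi : 0 < i) (hin : i < n) (k : ℕ) :
    IntegrableOn (fun v => (-1) ^ k * (v ^ k * lerchKernel b n i v) -
      b * (v ^ k * lerchKernel b n (n - i) v)) (Ioi 0) ∧
    ∫ v in Ioi (0 : ℝ), ((-1) ^ k * (v ^ k * lerchKernel b n i v) -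
      b * (v ^ k * lerchKernel b n (n - i) v)) =
      (-1) ^ k * k.factorial * ((n : ℝ) ^ (k + 1))⁻¹ * lerchTheta b (k + 1) i n := by
  have hi' : (0 : ℝ) < i := by exact_mod_cast hi
  have hin' : (i : ℝ) < n := by exact_mod_cast hin
  have hn : (0 : ℝ) < n := hi'.trans hin'
  have hni : (0 : ℝ) < n - i := by linarith
  by_cases hc : b = 1 ∧ k = 0
  · obtain ⟨rfl, rfl⟩ := hc
    simp only [pow_zero, one_mul, zero_add, Nat.factorial_zero, Nat.cast_one, pow_one, lerchTheta,
      and_self, if_true]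
    exact ⟨integrableOn_lerchKernel_sub hb hn hi' hni, integral_lerchKernel_sub hn hi' hin'⟩
  · have hk : b = 1 → k ≠ 0 := fun h h' => hc ⟨h, h'⟩
    have i1 := (integrableOn_pow_mul_lerchKernel hb hn hi' hk).const_mul ((-1 : ℝ) ^ k)
    have i2 := (integrableOn_pow_mul_lerchKernel hb hn hni hk).const_mul b
    refine ⟨i1.sub i2, ?_⟩
    rw [integral_sub i1 i2, integral_const_mul, integral_const_mul,
      integral_pow_mul_lerchKernel hb hn hi' hk, integral_pow_mul_lerchKernel hb hn hni hk,
      lerchTheta, if_neg (by simpa using hc)]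
    have : (-1 : ℝ) ^ k * (-1) ^ k = 1 := by rw [← mul_pow]; simp
    rw [pow_succ (-1 : ℝ) k]
    linear_combination (b * k.factorial * ((n : ℝ) ^ (k + 1))⁻¹ *
      lerchPhi b (k + 1) ((n - i) / n)) * this

/-- The contribution of the partial fraction with numerator `e^{is}`, `0 < i < n`. -/
lemma integral_theta_part (hb : b = 1 ∨ b = -1) {i : ℕ} (hi : 0 < i) (hin : i < n) (Q : ℕ)
    (t : ℝ) :
    IntegrableOn (fun v => (t - v) ^ Q * lerchKernel b n i v -
      b * ((t + v) ^ Q * lerchKernel b n (n - i) v)) (Ioi 0) ∧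
    ∫ v in Ioi (0 : ℝ), ((t - v) ^ Q * lerchKernel b n i v -
      b * ((t + v) ^ Q * lerchKernel b n (n - i) v)) =
      ∑ k ∈ Finset.range (Q + 1), (Q.choose k : ℝ) * t ^ (Q - k) *
        ((-1) ^ k * k.factorial * ((n : ℝ) ^ (k + 1))⁻¹ * lerchTheta b (k + 1) i n) := by
  have hexp : ∀ v : ℝ, (t - v) ^ Q * lerchKernel b n i v -
      b * ((t + v) ^ Q * lerchKernel b n (n - i) v) =
      ∑ k ∈ Finset.range (Q + 1), (Q.choose k : ℝ) * t ^ (Q - k) *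
        ((-1) ^ k * (v ^ k * lerchKernel b n i v) - b * (v ^ k * lerchKernel b n (n - i) v)) := by
    intro v
    rw [sub_eq_neg_add t, add_comm t, add_pow, add_pow, Finset.sum_mul, Finset.sum_mul,
      Finset.mul_sum, ← Finset.sum_sub_distrib]
    refine Finset.sum_congr rfl fun k _ => ?_
    rw [neg_pow v k]; ring
  simp_rw [hexp]
  have hi := fun k => (integral_theta_moment hb hi hin k)
  refine ⟨integrable_finsetSum _ fun k _ => (hi k).1.const_mul _, ?_⟩
  rw [integral_finsetSum _ fun k _ => (hi k).1.const_mul _]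
  refine Finset.sum_congr rfl fun k _ => ?_
  rw [integral_const_mul, (hi k).2]

/-- The contribution of the kernel itself: symmetrization leaves only the odd powers of `v`, that is
Lerch values of even order `k + 1`. -/
lemma integral_even_part (hb : b = 1 ∨ b = -1) (hn : 0 < n) (Q : ℕ) (t : ℝ) :
    IntegrableOn (fun v => polyLiKernel b n v * ((t + v) ^ Q - (t - v) ^ Q)) (Ioi 0) ∧
    ∫ v in Ioi (0 : ℝ), polyLiKernel b n v * ((t + v) ^ Q - (t - v) ^ Q) =
      ∑ k ∈ Finset.range (Q + 1), (1 - (-1) ^ k) * ((Q.choose k : ℝ) * t ^ (Q - k) *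
        (b * (k.factorial * ((n : ℝ) ^ (k + 1))⁻¹ * lerchPhi b (k + 1) 1))) := by
  have hn' : (0 : ℝ) < n := by exact_mod_cast hn
  have hexp : ∀ v : ℝ, polyLiKernel b n v * ((t + v) ^ Q - (t - v) ^ Q) =
      ∑ k ∈ Finset.range (Q + 1), (1 - (-1) ^ k) * ((Q.choose k : ℝ) * t ^ (Q - k) *
        (b * (v ^ k * lerchKernel b n n v))) := by
    intro v
    rw [sub_eq_neg_add t, add_comm t, add_pow, add_pow, ← Finset.sum_sub_distrib, Finset.mul_sum]
    refine Finset.sum_congr rfl fun k _ => ?_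
    rw [neg_pow v k, polyLiKernel]; ring
  simp_rw [hexp]
  have hterm : ∀ k : ℕ, IntegrableOn (fun v => (1 - (-1 : ℝ) ^ k) * ((Q.choose k : ℝ) *
      t ^ (Q - k) * (b * (v ^ k * lerchKernel b n n v)))) (Ioi 0) ∧
      ∫ v in Ioi (0 : ℝ), (1 - (-1 : ℝ) ^ k) * ((Q.choose k : ℝ) *
      t ^ (Q - k) * (b * (v ^ k * lerchKernel b n n v))) =
      (1 - (-1) ^ k) * ((Q.choose k : ℝ) * t ^ (Q - k) *
        (b * (k.factorial * ((n : ℝ) ^ (k + 1))⁻¹ * lerchPhi b (k + 1) 1))) := by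
    intro k
    -- the term `k = 0`, whose moment may diverge, has coefficient `0`
    rcases Nat.eq_zero_or_pos k with rfl | hk
    · simp
    · refine ⟨(((integrableOn_pow_mul_lerchKernel hb hn' hn'
        (fun _ => hk.ne')).const_mul _).const_mul _).const_mul _, ?_⟩
      rw [integral_const_mul, integral_const_mul, integral_const_mul,
        integral_pow_mul_lerchKernel hb hn' hn' (fun _ => hk.ne'), div_self hn'.ne']
  refine ⟨integrable_finsetSum _ fun k _ => (hterm k).1, ?_⟩
  rw [integral_finsetSum _ fun k _ => (hterm k).1]
  exact Finset.sum_congr rfl fun k _ => (hterm k).2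

end InnerIntegral

lemma setIntegral_Ioi_comp_add_left (F : ℝ → ℝ) (t : ℝ) :
    ∫ v in Ioi (0 : ℝ), F (t + v) = ∫ s in Ioi t, F s := by
  have := (measurePreserving_add_left volume t).setIntegral_preimage_emb
    (MeasurableEquiv.addLeft t).measurableEmbedding F (Ioi t)
  simpa using this

lemma integrableOn_Ioi_comp_add_left {F : ℝ → ℝ} {t : ℝ} (hF : IntegrableOn F (Ioi t)) :
    IntegrableOn (fun v => F (t + v)) (Ioi 0) := by
  have := ((measurePreserving_add_left volume t).integrableOn_comp_preimage
    (MeasurableEquiv.addLeft t).measurableEmbedding (f := F) (s := Ioi t)).2 hF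
  simpa [Function.comp_def] using this

lemma setIntegral_Ioi_comp_sub_left (F : ℝ → ℝ) (t : ℝ) :
    ∫ v in Ioi (0 : ℝ), F (t - v) = ∫ s in Iic t, F s := by
  have := (Measure.measurePreserving_sub_left volume t).setIntegral_preimage_emb
    (MeasurableEquiv.subLeft t).measurableEmbedding F (Iio t)
  rw [integral_Iic_eq_integral_Iio]
  simpa using this

lemma integrableOn_Ioi_comp_sub_left {F : ℝ → ℝ} {t : ℝ} (hF : IntegrableOn F (Iio t)) :
    IntegrableOn (fun v => F (t - v)) (Ioi 0) := by
  have := ((Measure.measurePreserving_sub_left volume t).integrableOn_comp_preimage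
    (MeasurableEquiv.subLeft t).measurableEmbedding (f := F) (s := Iio t)).2 hF
  simpa [Function.comp_def] using this

/-- With `A(s) = a e^s / (1 - a e^s)`, the function `s^Q (A(s) + 1_{s > 0})` has parity opposite
to that of `s^Q`; moving the cut from `0` to `t` costs `t^(Q+1) / (Q+1)`. -/
lemma integral_shifted_part {a : ℝ} (ha : a = 1 ∨ a = -1) {Q : ℕ} (hQ : a = 1 → Q ≠ 0) {t : ℝ}
    (ht : 0 < t) :
    IntegrableOn (fun v => (t + v) ^ Q * (a * Real.exp (t + v) / (1 - a * Real.exp (t + v)) + 1) +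
      (t - v) ^ Q * (a * Real.exp (t - v) / (1 - a * Real.exp (t - v)))) (Ioi 0) ∧
    ∫ v in Ioi (0 : ℝ), ((t + v) ^ Q * (a * Real.exp (t + v) / (1 - a * Real.exp (t + v)) + 1) +
      (t - v) ^ Q * (a * Real.exp (t - v) / (1 - a * Real.exp (t - v)))) =
      -(1 + (-1) ^ (Q + 1)) * (a * (Q.factorial * lerchPhi a (Q + 1) 1)) -
        t ^ (Q + 1) / (Q + 1) := by
  set A : ℝ → ℝ := fun s => a * Real.exp s / (1 - a * Real.exp s) with hA
  have iM := (integrableOn_pow_mul_lerchKernel ha one_pos one_pos hQ).const_mul a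
  have hM : ∫ s in Ioi (0 : ℝ), a * (s ^ Q * lerchKernel a 1 1 s) =
      a * (Q.factorial * lerchPhi a (Q + 1) 1) := by
    rw [integral_const_mul, integral_pow_mul_lerchKernel ha one_pos one_pos hQ]
    simp
  have hApos : ∀ s, 0 < s → s ^ Q * (A s + 1) = -(a * (s ^ Q * lerchKernel a 1 1 s)) := by
    intro s hs
    simp only [hA, mul_exp_div_one_sub_mul_exp ha hs, lerchKernel, one_mul]
    ring
  have iP : IntegrableOn (fun s => s ^ Q * (A s + 1)) (Ioi 0) :=
    IntegrableOn.congr_fun iM.neg (fun s hs => (hApos s hs).symm) measurableSet_Ioi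
  have hP : ∫ s in Ioi (0 : ℝ), s ^ Q * (A s + 1) =
      -(a * (Q.factorial * lerchPhi a (Q + 1) 1)) := by
    rw [← hM, ← integral_neg]
    exact setIntegral_congr_fun measurableSet_Ioi hApos
  have hAneg : ∀ v : ℝ, (-v) ^ Q * A (-v) = (-1) ^ Q * (a * (v ^ Q * lerchKernel a 1 1 v)) := by
    intro v
    simp only [hA, lerchKernel, one_mul, neg_pow v Q]
    ring
  have iN' : IntegrableOn (fun v => (-v) ^ Q * A (-v)) (Ioi 0) := by
    simp_rw [hAneg]; exact iM.const_mul _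
  have iN : IntegrableOn (fun s => s ^ Q * A s) (Iic 0) := by
    rw [integrableOn_Iic_iff_integrableOn_Iio enorm_ne_top]
    rw [← neg_zero] at iN'
    simpa using iN'.comp_neg_Iio
  have hN : ∫ s in Iic (0 : ℝ), s ^ Q * A s =
      (-1) ^ Q * (a * (Q.factorial * lerchPhi a (Q + 1) 1)) := by
    have := integral_comp_neg_Ioi 0 (fun s => s ^ Q * A s)
    rw [neg_zero] at this
    rw [← this, ← hM, ← integral_const_mul]
    simp_rw [hAneg]
  have ipow : IntegrableOn (fun s : ℝ => s ^ Q) (Ioc 0 t) :=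
    ((continuous_pow Q).integrableOn_Icc (a := 0) (b := t)).mono_set Ioc_subset_Icc_self
  have hpow : ∫ s in Ioc (0 : ℝ) t, s ^ Q = t ^ (Q + 1) / (Q + 1) := by
    rw [← intervalIntegral.integral_of_le ht.le, integral_pow]; simp
  have iPt : IntegrableOn (fun s => s ^ Q * (A s + 1)) (Ioc 0 t) := iP.mono_set Ioc_subset_Ioi_self
  have iPi : IntegrableOn (fun s => s ^ Q * (A s + 1)) (Ioi t) :=
    iP.mono_set (Ioi_subset_Ioi ht.le)
  have hsub : ∀ s : ℝ, s ^ Q * A s = s ^ Q * (A s + 1) - s ^ Q := fun s => by ring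
  have iAt : IntegrableOn (fun s => s ^ Q * A s) (Ioc 0 t) := by
    simp_rw [hsub]; exact iPt.sub ipow
  have iAl : IntegrableOn (fun s => s ^ Q * A s) (Iic t) := by
    rw [← Iic_union_Ioc_eq_Iic ht.le]; exact iN.union iAt
  have j1 := integrableOn_Ioi_comp_add_left iPi
  have j2 := integrableOn_Ioi_comp_sub_left (iAl.mono_set Iio_subset_Iic_self)
  refine ⟨j1.add j2, ?_⟩
  have e := integral_add j1 j2
  refine e.trans ?_
  rw [setIntegral_Ioi_comp_add_left (fun s => s ^ Q * (A s + 1)),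
    setIntegral_Ioi_comp_sub_left (fun s => s ^ Q * A s), ← Iic_union_Ioc_eq_Iic ht.le,
    setIntegral_union (Iic_disjoint_Ioc le_rfl) measurableSet_Ioc iN iAt, hN]
  have e1 : ∫ s in Ioc (0 : ℝ) t, s ^ Q * A s =
      (∫ s in Ioc (0 : ℝ) t, s ^ Q * (A s + 1)) - t ^ (Q + 1) / (Q + 1) := by
    rw [← hpow, ← integral_sub iPt ipow]
    simp_rw [← hsub]
  have e2 : ∫ s in Ioi (0 : ℝ), s ^ Q * (A s + 1) =
      (∫ s in Ioc (0 : ℝ) t, s ^ Q * (A s + 1)) + ∫ s in Ioi t, s ^ Q * (A s + 1) := by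
    rw [← setIntegral_union (Ioc_disjoint_Ioi le_rfl) measurableSet_Ioi iPt iPi,
      Ioc_union_Ioi_eq_Ioi ht.le]
  rw [e1, pow_succ]
  linear_combination hP - e2

lemma one_sub_mul_exp_ne_zero {a : ℝ} (ha : a = 1 ∨ a = -1) {s : ℝ} (hs : s ≠ 0) :
    1 - a * Real.exp s ≠ 0 := by
  rcases ha with rfl | rfl
  · rw [one_mul, sub_ne_zero]
    exact fun h => hs (Real.exp_eq_one_iff s |>.1 h.symm)
  · have := Real.exp_pos s
    linarith

lemma sign_pow_mul {a b : ℝ} (ha : a = 1 ∨ a = -1) (hb : b = 1 ∨ b = -1) (n : ℕ) :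
    a ^ n * b = 1 ∨ a ^ n * b = -1 := by
  rcases ha with rfl | rfl
  · simpa using hb
  · rcases neg_one_pow_eq_or ℝ n with h | h <;> rcases hb with rfl | rfl <;> simp [h]

lemma sum_one_sub_neg_one_pow_mul (G : ℕ → ℝ) (q : ℕ) :
    ∑ k ∈ Finset.range q, (1 - (-1) ^ k) * G k = 2 * ∑ j ∈ Finset.range (q / 2), G (2 * j + 1) := by
  induction q using Nat.twoStepInduction with
  | zero => simp
  | one => simp
  | more q ih _ =>
    rw [Finset.sum_range_succ, Finset.sum_range_succ, ih,
      show (q + 2) / 2 = q / 2 + 1 by omega, Finset.sum_range_succ]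
    rcases Nat.even_or_odd' q with ⟨r, rfl | rfl⟩
    · have h1 : (-1 : ℝ) ^ (2 * r) = 1 := by simp [pow_mul]
      rw [show 2 * r / 2 = r by omega, pow_succ, h1]
      ring
    · have h1 : (-1 : ℝ) ^ (2 * r) = 1 := by simp [pow_mul]
      rw [show (2 * r + 1) / 2 = r by omega,
        show (-1 : ℝ) ^ (2 * r + 1 + 1) = 1 by rw [pow_succ, pow_succ, h1]; norm_num, pow_succ, h1]
      ring

section InnerIntegralValue

variable {a b : ℝ}

/-- The partial fraction decomposition in exponential form, at the points `t - v` and `t + v`. -/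
lemma symm_kernel_eq_partialFractions (ha : a = 1 ∨ a = -1) (hb : b = 1 ∨ b = -1) (N : ℕ)
    {t v : ℝ} (ht : 0 < t) (hv : 0 < v) (hvt : v ≠ t) :
    polyLiKernel b (N + 1 : ℕ) v / (1 - a * Real.exp (t - v)) =
      b * a ^ N * lerchKernel (a ^ (N + 1) * b) (N + 1 : ℕ) (N + 1 : ℕ) t *
        (a * (a * Real.exp (t - v) / (1 - a * Real.exp (t - v)) - polyLiKernel b (N + 1 : ℕ) v) -
          ∑ i ∈ Finset.range N, a ^ i * Real.exp ((i + 1 : ℕ) * t) *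
            lerchKernel b (N + 1 : ℕ) (i + 1 : ℕ) v) ∧
    (-1 - polyLiKernel b (N + 1 : ℕ) v) / (1 - a * Real.exp (t + v)) =
      b * a ^ N * lerchKernel (a ^ (N + 1) * b) (N + 1 : ℕ) (N + 1 : ℕ) t *
        (a * (a * Real.exp (t + v) / (1 - a * Real.exp (t + v)) -
            (-1 - polyLiKernel b (N + 1 : ℕ) v)) -
          ∑ i ∈ Finset.range N, a ^ i * Real.exp ((i + 1 : ℕ) * t) *
            (-(b * lerchKernel b (N + 1 : ℕ) ((N + 1 : ℕ) - (i + 1 : ℕ)) v))) := by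
  have hn : (0 : ℝ) < (N + 1 : ℕ) := by positivity
  have hx : 0 < ((N + 1 : ℕ) : ℝ) * v := mul_pos hn hv
  have hbb : b * b = 1 := by rcases hb with rfl | rfl <;> norm_num
  have h3 := (one_sub_mul_exp_neg_pos (sign_pow_mul ha hb (N + 1)) (mul_pos hn ht)).ne'
  have h2 := (one_sub_mul_exp_neg_pos hb hx).ne'
  have h2' := one_sub_mul_exp_ne_zero hb hx.ne'
  have e1 : Real.exp (-((N + 1 : ℕ) * t)) * Real.exp (t - v) ^ (N + 1) =
      Real.exp (-((N + 1 : ℕ) * v)) := by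
    rw [← Real.exp_nat_mul, ← Real.exp_add]; ring_nf
  have e2 : Real.exp (-((N + 1 : ℕ) * t)) * Real.exp (t + v) ^ (N + 1) =
      Real.exp ((N + 1 : ℕ) * v) := by
    rw [← Real.exp_nat_mul, ← Real.exp_add]; ring_nf
  constructor
  · have h := pow_mul_div_eq_partialFractions (b := b) ha N (X := Real.exp (t - v))
      (Y := Real.exp (-((N + 1 : ℕ) * t)))
      (one_sub_mul_exp_ne_zero ha (sub_ne_zero.2 hvt.symm)) (by rwa [e1]) h3
    rw [e1, mul_div_assoc b] at h
    refine h.trans ?_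
    simp only [polyLiKernel, lerchKernel]
    congr 2
    refine Finset.sum_congr rfl fun i _ => ?_
    have e3 : Real.exp (t - v) ^ (i + 1) = Real.exp ((i + 1 : ℕ) * t) *
        Real.exp (-((i + 1 : ℕ) * v)) := by
      rw [← Real.exp_nat_mul, ← Real.exp_add]; ring_nf
    rw [e3]
    ring
  · have h := pow_mul_div_eq_partialFractions (b := b) ha N (X := Real.exp (t + v))
      (Y := Real.exp (-((N + 1 : ℕ) * t)))
      (one_sub_mul_exp_ne_zero ha (by linarith)) (by rwa [e2]) h3
    rw [e2, mul_exp_div_one_sub_mul_exp hb hx] at h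
    refine h.trans ?_
    simp only [polyLiKernel, lerchKernel]
    congr 2
    refine Finset.sum_congr rfl fun i _ => ?_
    rw [mul_assoc (a ^ i)]
    congr 1
    have e3 : Real.exp (t + v) ^ (i + 1) = Real.exp ((i + 1 : ℕ) * t) *
        (Real.exp (-(((N + 1 : ℕ) - (i + 1 : ℕ)) * v)) * Real.exp ((N + 1 : ℕ) * v)) := by
      rw [← Real.exp_nat_mul, ← Real.exp_add, ← Real.exp_add]; ring_nf
    have e4 : Real.exp (-((N + 1 : ℕ) * v)) * Real.exp ((N + 1 : ℕ) * v) = 1 := by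
      rw [← Real.exp_add]; simp
    have e5 : Real.exp ((N + 1 : ℕ) * v) / (1 - b * Real.exp ((N + 1 : ℕ) * v)) =
        -b / (1 - b * Real.exp (-((N + 1 : ℕ) * v))) := by
      rw [div_eq_div_iff h2' h2]
      linear_combination -Real.exp ((N + 1 : ℕ) * v) * hbb - b * e4
    rw [e3, ← mul_assoc, mul_div_assoc, e5]
    ring

/-- The inner integral as an explicit function of `t`: powers of `t` times exponentials times
`1 / (1 - a^n b e^{-nt})`. -/
lemma integral_symm_kernel_mul_weight (ha : a = 1 ∨ a = -1) (hb : b = 1 ∨ b = -1) (N : ℕ) {Q : ℕ}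
    (hQ : a = 1 → Q ≠ 0) {h : ℝ → ℝ} (hh : ∀ s, s ≠ 0 → h s = s ^ Q / (1 - a * Real.exp s))
    {t : ℝ} (ht : 0 < t) :
    ∫ v in Ioi (0 : ℝ), (polyLiKernel b (N + 1 : ℕ) v * h (t - v) +
      (-1 - polyLiKernel b (N + 1 : ℕ) v) * h (t + v)) =
    b * a ^ N * lerchKernel (a ^ (N + 1) * b) (N + 1 : ℕ) (N + 1 : ℕ) t *
      (a * (-(1 + (-1) ^ (Q + 1)) * (a * (Q.factorial * lerchPhi a (Q + 1) 1)) +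
        ∑ j ∈ Finset.range ((Q + 1) / 2 + 1), 2 * b * (Q.factorial / (Q + 1 - 2 * j).factorial *
          (((N + 1 : ℕ) : ℝ) ^ (2 * j))⁻¹ * lerchPhi b (2 * j) 1) * t ^ (Q + 1 - 2 * j)) -
      ∑ i ∈ Finset.range N, a ^ i * Real.exp ((i + 1 : ℕ) * t) *
        ∑ k ∈ Finset.range (Q + 1), (Q.choose k : ℝ) * t ^ (Q - k) *
        ((-1) ^ k * k.factorial * (((N + 1 : ℕ) : ℝ) ^ (k + 1))⁻¹ *
          lerchTheta b (k + 1) (i + 1 : ℕ) (N + 1 : ℕ))) := by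
  obtain ⟨i1, v1⟩ := integral_shifted_part ha hQ ht
  obtain ⟨i2, v2⟩ := integral_even_part hb N.succ_pos Q t
  have h3 := fun i (hi : i ∈ Finset.range N) => integral_theta_part hb i.succ_pos
    (Nat.succ_lt_succ (Finset.mem_range.1 hi)) Q t
  simp only [Nat.succ_eq_add_one] at h3 i2 v2
  have i3 := integrable_finsetSum _ fun i hi =>
    (h3 i hi).1.const_mul (a ^ i * Real.exp ((i + 1 : ℕ) * t))
  have v3 := integral_finsetSum _ fun i hi =>
    (h3 i hi).1.const_mul (a ^ i * Real.exp ((i + 1 : ℕ) * t))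
  have hpt : ∀ᵐ v ∂(volume.restrict (Ioi (0 : ℝ))), (polyLiKernel b (N + 1 : ℕ) v * h (t - v) +
      (-1 - polyLiKernel b (N + 1 : ℕ) v) * h (t + v)) =
      b * a ^ N * lerchKernel (a ^ (N + 1) * b) (N + 1 : ℕ) (N + 1 : ℕ) t * (a *
      (((t + v) ^ Q * (a * Real.exp (t + v) / (1 - a * Real.exp (t + v)) + 1) +
      (t - v) ^ Q * (a * Real.exp (t - v) / (1 - a * Real.exp (t - v)))) +
      polyLiKernel b (N + 1 : ℕ) v * ((t + v) ^ Q - (t - v) ^ Q)) -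
      ∑ i ∈ Finset.range N, a ^ i * Real.exp ((i + 1 : ℕ) * t) *
        ((t - v) ^ Q * lerchKernel b (N + 1 : ℕ) (i + 1 : ℕ) v -
      b * ((t + v) ^ Q * lerchKernel b (N + 1 : ℕ) ((N + 1 : ℕ) - (i + 1 : ℕ)) v))) := by
    filter_upwards [ae_restrict_mem measurableSet_Ioi,
      ae_restrict_of_ae (compl_mem_ae_iff.2 (measure_singleton t))] with v hv hvt
    have hv : 0 < v := hv
    have hvt : v ≠ t := hvt
    obtain ⟨p1, p2⟩ := symm_kernel_eq_partialFractions ha hb N ht hv hvt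
    rw [hh _ (sub_ne_zero.2 hvt.symm), hh _ (by linarith), mul_div_left_comm, p1,
      mul_div_left_comm, p2]
    have hsum : ∑ i ∈ Finset.range N, a ^ i * Real.exp ((i + 1 : ℕ) * t) *
        ((t - v) ^ Q * lerchKernel b (N + 1 : ℕ) (i + 1 : ℕ) v -
      b * ((t + v) ^ Q * lerchKernel b (N + 1 : ℕ) ((N + 1 : ℕ) - (i + 1 : ℕ)) v)) =
      (t - v) ^ Q * (∑ i ∈ Finset.range N, a ^ i * Real.exp ((i + 1 : ℕ) * t) *
            lerchKernel b (N + 1 : ℕ) (i + 1 : ℕ) v) +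
      (t + v) ^ Q * ∑ i ∈ Finset.range N, a ^ i * Real.exp ((i + 1 : ℕ) * t) *
            (-(b * lerchKernel b (N + 1 : ℕ) ((N + 1 : ℕ) - (i + 1 : ℕ)) v)) := by
      rw [Finset.mul_sum, Finset.mul_sum, ← Finset.sum_add_distrib]
      exact Finset.sum_congr rfl fun i _ => by ring
    rw [hsum]
    ring
  have v123 := integral_sub ((i1.add i2).const_mul a) i3
  simp only [Pi.add_apply] at v123
  rw [integral_congr_ae hpt, integral_const_mul, v123, integral_const_mul]
  have v12 := integral_add i1 i2
  rw [v12, v1, v2, v3]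
  have hT : -(1 + (-1) ^ (Q + 1)) * (a * (Q.factorial * lerchPhi a (Q + 1) 1)) -
        t ^ (Q + 1) / (Q + 1) + ∑ k ∈ Finset.range (Q + 1), (1 - (-1) ^ k) *
        ((Q.choose k : ℝ) * t ^ (Q - k) * (b * (k.factorial * (((N + 1 : ℕ) : ℝ) ^ (k + 1))⁻¹ *
          lerchPhi b (k + 1) 1))) =
      -(1 + (-1) ^ (Q + 1)) * (a * (Q.factorial * lerchPhi a (Q + 1) 1)) +
        ∑ j ∈ Finset.range ((Q + 1) / 2 + 1), 2 * b * (Q.factorial / (Q + 1 - 2 * j).factorial *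
          (((N + 1 : ℕ) : ℝ) ^ (2 * j))⁻¹ * lerchPhi b (2 * j) 1) * t ^ (Q + 1 - 2 * j) := by
    rw [sum_one_sub_neg_one_pow_mul, Finset.sum_range_succ' _ ((Q + 1) / 2), Finset.mul_sum]
    -- the summand `j = 0` is the shift term: `2 b Φ(b, 0, 1) = -1` for both signs `b`
    have h0 : 2 * b * (Q.factorial / (Q + 1 - 2 * 0).factorial *
          (((N + 1 : ℕ) : ℝ) ^ (2 * 0))⁻¹ * lerchPhi b (2 * 0) 1) * t ^ (Q + 1 - 2 * 0) =
        -(t ^ (Q + 1) / (Q + 1)) := by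
      have hf : (Q.factorial : ℝ) ≠ 0 := by positivity
      have hq : (Q : ℝ) + 1 ≠ 0 := by positivity
      simp only [mul_zero, Nat.sub_zero, pow_zero, inv_one, mul_one, Nat.factorial_succ,
        Nat.cast_mul, Nat.cast_succ, lerchPhi, if_true]
      rcases hb with rfl | rfl
      · simp only [if_true]; field_simp; norm_num
      · norm_num; field_simp
    have hs : ∀ j ∈ Finset.range ((Q + 1) / 2), 2 * ((Q.choose (2 * j + 1) : ℝ) *
        t ^ (Q - (2 * j + 1)) * (b * ((2 * j + 1).factorial *
        (((N + 1 : ℕ) : ℝ) ^ (2 * j + 1 + 1))⁻¹ * lerchPhi b (2 * j + 1 + 1) 1))) =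
        2 * b * (Q.factorial / (Q + 1 - 2 * (j + 1)).factorial *
          (((N + 1 : ℕ) : ℝ) ^ (2 * (j + 1)))⁻¹ * lerchPhi b (2 * (j + 1)) 1) *
          t ^ (Q + 1 - 2 * (j + 1)) := by
      intro j hj
      have hj := Finset.mem_range.1 hj
      have hle : 2 * j + 1 ≤ Q := by omega
      rw [show Q + 1 - 2 * (j + 1) = Q - (2 * j + 1) by omega,
        show 2 * (j + 1) = 2 * j + 1 + 1 by ring]
      have hc : (Q.choose (2 * j + 1) : ℝ) * (2 * j + 1).factorial * (Q - (2 * j + 1)).factorial =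
          Q.factorial := by exact_mod_cast Nat.choose_mul_factorial_mul_factorial hle
      rw [← hc]
      have hf : ((Q - (2 * j + 1)).factorial : ℝ) ≠ 0 := by positivity
      field_simp
    rw [Finset.sum_congr rfl hs, h0]
    ring
  rw [hT]
  congr 2
  refine Finset.sum_congr rfl fun i hi => ?_
  rw [integral_const_mul, (h3 i hi).2]

end InnerIntegralValue

/-! ### Moments in the outer variable and the final formula -/

lemma integrableOn_Ioi_iff_comp_exp (F : ℝ → ℝ) :
    IntegrableOn F (Ioi 0) ↔ Integrable fun s => Real.exp s * F (Real.exp s) := by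
  have h := integrableOn_image_iff_integrableOn_abs_deriv_smul MeasurableSet.univ
    (fun x _ => (Real.hasDerivAt_exp x).hasDerivWithinAt) Real.exp_injective.injOn F
  simpa [Real.range_exp, abs_of_pos (Real.exp_pos _)] using h

lemma integral_Ioi_eq_integral_comp_exp (F : ℝ → ℝ) :
    ∫ x in Ioi (0 : ℝ), F x = ∫ s, Real.exp s * F (Real.exp s) := by
  have h := integral_image_eq_integral_abs_deriv_smul MeasurableSet.univ
    (fun x _ => (Real.hasDerivAt_exp x).hasDerivWithinAt) Real.exp_injective.injOn F
  simpa [Real.range_exp, abs_of_pos (Real.exp_pos _)] using h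

lemma integrableOn_and_integral_Ioi_of_comp_exp {F G : ℝ → ℝ} (hG : Integrable G)
    (hFG : ∀ s, s ≠ 0 → Real.exp s * F (Real.exp s) = G s) :
    IntegrableOn F (Ioi 0) ∧ ∫ x in Ioi (0 : ℝ), F x = ∫ s, G s := by
  have hae : (fun s => Real.exp s * F (Real.exp s)) =ᵐ[volume] G := by
    filter_upwards [compl_mem_ae_iff.2 (measure_singleton (0 : ℝ))] with s hs
    exact hFG s hs
  exact ⟨(integrableOn_Ioi_iff_comp_exp F).2 (hG.congr hae.symm),
    (integral_Ioi_eq_integral_comp_exp F).trans (integral_congr_ae hae)⟩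

/-- The constants in front of `Φ(b, r, 1)` or `Θ(b, r, ·, n)` times a Lerch value of order
`m + l + 1` collapse to a binomial coefficient and the power `n^{-(l+r)}`. -/
lemma choose_factorial_scaling (m l r : ℕ) {x : ℝ} (hx : x ≠ 0) :
    x ^ (m + 1) * (m.factorial : ℝ)⁻¹ * ((m + l).factorial * (x ^ (m + l + 1))⁻¹) *
      (l.factorial : ℝ)⁻¹ * (x ^ r)⁻¹ = ((m + l).choose m : ℝ) * (x ^ (l + r))⁻¹ := by
  have h : ((m + l).choose m : ℝ) * m.factorial * l.factorial = (m + l).factorial := by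
    have := Nat.choose_mul_factorial_mul_factorial (Nat.le_add_right m l)
    rw [Nat.add_sub_cancel_left] at this
    exact_mod_cast this
  have h1 : (m.factorial : ℝ) ≠ 0 := by positivity
  have h2 : (l.factorial : ℝ) ≠ 0 := by positivity
  rw [← h, show m + l + 1 = (m + 1) + l by ring, pow_add x (m + 1) l, pow_add x l r]
  field_simp

/-- Moments of the explicit inner integral. -/
lemma integral_pow_mul_inner {a b : ℝ} (ha : a = 1 ∨ a = -1) (hb : b = 1 ∨ b = -1) (N m Q : ℕ)
    (hm : a ^ (N + 1) * b = 1 → m ≠ 0) (C : ℝ) (D : ℕ → ℝ) (E : ℕ → ℕ → ℝ) :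
    ∫ t in Ioi (0 : ℝ), t ^ m * (lerchKernel (a ^ (N + 1) * b) (N + 1 : ℕ) (N + 1 : ℕ) t *
      (C + ∑ j ∈ Finset.range ((Q + 1) / 2 + 1), D j * t ^ (Q + 1 - 2 * j) -
        ∑ i ∈ Finset.range N, Real.exp ((i + 1 : ℕ) * t) *
          ∑ k ∈ Finset.range (Q + 1), E i k * t ^ (Q - k))) =
    C * (m.factorial * (((N + 1 : ℕ) : ℝ) ^ (m + 1))⁻¹ * lerchPhi (a ^ (N + 1) * b) (m + 1) 1) +
    ∑ j ∈ Finset.range ((Q + 1) / 2 + 1), D j * ((m + (Q + 1 - 2 * j)).factorial *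
      (((N + 1 : ℕ) : ℝ) ^ (m + (Q + 1 - 2 * j) + 1))⁻¹ *
      lerchPhi (a ^ (N + 1) * b) (m + (Q + 1 - 2 * j) + 1) 1) -
    ∑ i ∈ Finset.range N, ∑ k ∈ Finset.range (Q + 1), E i k * ((m + (Q - k)).factorial *
      (((N + 1 : ℕ) : ℝ) ^ (m + (Q - k) + 1))⁻¹ * lerchPhi (a ^ (N + 1) * b) (m + (Q - k) + 1)
        (((N + 1 : ℕ) - (i + 1 : ℕ)) / (N + 1 : ℕ))) := by
  have hβ := sign_pow_mul ha hb (N + 1)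
  set β := a ^ (N + 1) * b with hβdef
  have hn : (0 : ℝ) < (N + 1 : ℕ) := by positivity
  have hm' : ∀ l, β = 1 → m + l ≠ 0 := fun l h => by have := hm h; omega
  have hc : ∀ i ∈ Finset.range N, (0 : ℝ) < (N + 1 : ℕ) - (i + 1 : ℕ) := by
    intro i hi
    have : ((i + 1 : ℕ) : ℝ) < (N + 1 : ℕ) := by
      exact_mod_cast Nat.succ_lt_succ (Finset.mem_range.1 hi)
    linarith
  have I1 := fun l => integrableOn_pow_mul_lerchKernel hβ hn hn (hm' l)
  have V1 := fun l => integral_pow_mul_lerchKernel hβ hn hn (hm' l)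
  have I2 := fun l i hi => integrableOn_pow_mul_lerchKernel hβ hn (hc i hi) (hm' l)
  have V2 := fun l i hi => integral_pow_mul_lerchKernel hβ hn (hc i hi) (hm' l)
  have hshift : ∀ (i : ℕ) (t : ℝ), lerchKernel β (N + 1 : ℕ) (N + 1 : ℕ) t *
      Real.exp ((i + 1 : ℕ) * t) = lerchKernel β (N + 1 : ℕ) ((N + 1 : ℕ) - (i + 1 : ℕ)) t := by
    intro i t
    simp only [lerchKernel]
    rw [div_mul_eq_mul_div, ← Real.exp_add]
    ring_nf
  have hexp : ∀ t : ℝ, t ^ m * (lerchKernel β (N + 1 : ℕ) (N + 1 : ℕ) t *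
      (C + ∑ j ∈ Finset.range ((Q + 1) / 2 + 1), D j * t ^ (Q + 1 - 2 * j) -
        ∑ i ∈ Finset.range N, Real.exp ((i + 1 : ℕ) * t) *
          ∑ k ∈ Finset.range (Q + 1), E i k * t ^ (Q - k))) =
      C * (t ^ (m + 0) * lerchKernel β (N + 1 : ℕ) (N + 1 : ℕ) t) +
      ∑ j ∈ Finset.range ((Q + 1) / 2 + 1), D j * (t ^ (m + (Q + 1 - 2 * j)) *
        lerchKernel β (N + 1 : ℕ) (N + 1 : ℕ) t) -
      ∑ i ∈ Finset.range N, ∑ k ∈ Finset.range (Q + 1), E i k * (t ^ (m + (Q - k)) *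
        lerchKernel β (N + 1 : ℕ) ((N + 1 : ℕ) - (i + 1 : ℕ)) t) := by
    intro t
    rw [mul_sub, mul_sub, mul_add, mul_add, Finset.mul_sum, Finset.mul_sum, Finset.mul_sum,
      Finset.mul_sum]
    congr 1
    · congr 1
      · rw [add_zero]; ring
      · exact Finset.sum_congr rfl fun j _ => by rw [pow_add]; ring
    · refine Finset.sum_congr rfl fun i _ => ?_
      rw [← mul_assoc (lerchKernel _ _ _ _), hshift, Finset.mul_sum, Finset.mul_sum]
      exact Finset.sum_congr rfl fun k _ => by rw [pow_add]; ring
  simp_rw [hexp]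
  have J1 := (I1 0).const_mul C
  have J2 := integrable_finsetSum (Finset.range ((Q + 1) / 2 + 1))
    fun j _ => (I1 (Q + 1 - 2 * j)).const_mul (D j)
  have J3 := integrable_finsetSum (Finset.range N) fun i hi =>
    integrable_finsetSum (Finset.range (Q + 1)) fun k _ => (I2 (Q - k) i hi).const_mul (E i k)
  have e1 := integral_sub (J1.add J2) J3
  have e2 := integral_add J1 J2
  simp only [Pi.add_apply] at e1
  rw [e1, e2, integral_const_mul, V1, div_self hn.ne', integral_finsetSum _
    fun j _ => (I1 (Q + 1 - 2 * j)).const_mul (D j), integral_finsetSum _ fun i hi =>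
    integrable_finsetSum (Finset.range (Q + 1)) fun k _ => (I2 (Q - k) i hi).const_mul (E i k)]
  congr 1
  · congr 1
    refine Finset.sum_congr rfl fun j _ => ?_
    rw [integral_const_mul, V1, div_self hn.ne']
  · refine Finset.sum_congr rfl fun i hi => ?_
    rw [integral_finsetSum _ fun k _ => (I2 (Q - k) i hi).const_mul (E i k)]
    refine Finset.sum_congr rfl fun k _ => ?_
    rw [integral_const_mul, V2 _ i hi]

theorem theorem1 (p q n : ℕ) (hp : 0 < p) (hq : 0 < q) (hn : 0 < n) (a b : ℝ)
    (ha : a = 1 ∨ a = -1) (hb : b = 1 ∨ b = -1)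
    (hpab : a ^ n * b = 1 → p ≠ 1) (hqa : a = 1 → q ≠ 1) :
    IntegrableOn
      (fun x : ℝ => Real.log x ^ (q - 1) * polyLi p (b * x ^ n) / (x * (1 - a * x))) (Ioi 0) ∧
    ∫ x in Ioi (0 : ℝ), Real.log x ^ (q - 1) * polyLi p (b * x ^ n) / (x * (1 - a * x)) =
      -(a ^ (n - 1) * b * (1 + (-1) ^ q) * ((q - 1).factorial : ℝ) *
          lerchPhi (a ^ n * b) p 1 * lerchPhi a q 1)
      + 2 * a ^ n * ((n : ℝ) ^ q)⁻¹ * ((q - 1).factorial : ℝ) *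
          ∑ j ∈ Finset.range (q / 2 + 1),
            ((p + q - 2 * j - 1).choose (p - 1) : ℝ) *
              lerchPhi b (2 * j) 1 * lerchPhi (a ^ n * b) (p + q - 2 * j) 1
      + a ^ (n - 1) * b * ((n : ℝ) ^ q)⁻¹ * ((q - 1).factorial : ℝ) *
          ∑ j ∈ Finset.Icc 2 n, ∑ k ∈ Finset.Icc 1 q,
            ((p + q - k - 1).choose (p - 1) : ℝ) * a ^ j * (-1) ^ k *
              lerchTheta b k ((j : ℝ) - 1) n *
              lerchPhi (a ^ n * b) (p + q - k) (((n : ℝ) - j + 1) / n) := by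
  obtain ⟨m, rfl⟩ : ∃ m, p = m + 1 := ⟨p - 1, by omega⟩
  obtain ⟨Q, rfl⟩ : ∃ Q, q = Q + 1 := ⟨q - 1, by omega⟩
  obtain ⟨N, rfl⟩ : ∃ N, n = N + 1 := ⟨n - 1, by omega⟩
  simp only [Nat.add_sub_cancel]
  have hQ : a = 1 → Q ≠ 0 := fun h h0 => hqa h (by omega)
  have hm : a ^ (N + 1) * b = 1 → m ≠ 0 := fun h h0 => hpab h (by omega)
  have hn' : (1 : ℝ) ≤ (N + 1 : ℕ) := by exact_mod_cast Nat.succ_pos N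
  have hn0 : ((N + 1 : ℕ) : ℝ) ≠ 0 := by positivity
  have haa : a * a = 1 := by rcases ha with rfl | rfl <;> norm_num
  have hbb : b * b = 1 := by rcases hb with rfl | rfl <;> norm_num
  obtain ⟨h, C, M, hmeas, hval, hbd, hdiff⟩ := exists_weight ha hq hqa
  simp only [Nat.add_sub_cancel] at hval
  obtain ⟨hint, hexch⟩ := integral_mul_symm_convolution m hmeas
    (measurable_polyLiKernel b (N + 1 : ℕ))
    (fun v hv => abs_polyLiKernel_le hb hn' hv) hbd hdiff
  set κ : ℝ := ((N + 1 : ℕ) : ℝ) ^ (m + 1) * (m.factorial : ℝ)⁻¹ with hκ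
  obtain ⟨hI, hV⟩ := integrableOn_and_integral_Ioi_of_comp_exp (F := fun x : ℝ =>
    Real.log x ^ Q * polyLi (m + 1) (b * x ^ (N + 1)) / (x * (1 - a * x))) (hint.const_mul κ) (by
      intro s hs
      simp only [Real.log_exp]
      rw [polyLi_mul_exp_pow m N.succ_pos hb hs, hval s hs]
      have h1 := one_sub_mul_exp_ne_zero ha hs
      have h2 := (Real.exp_pos s).ne'
      simp only [hκ, Nat.succ_eq_add_one]
      field_simp)
  refine ⟨hI, hV.trans ?_⟩
  obtain ⟨D, hD⟩ : ∃ D : ℕ → ℝ, ∀ j, D j = a * (2 * b * (Q.factorial /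
      (Q + 1 - 2 * j).factorial * (((N + 1 : ℕ) : ℝ) ^ (2 * j))⁻¹ * lerchPhi b (2 * j) 1)) :=
    ⟨_, fun _ => rfl⟩
  obtain ⟨E, hE⟩ : ∃ E : ℕ → ℕ → ℝ, ∀ i k, E i k = a ^ i * ((Q.choose k : ℝ) *
      ((-1) ^ k * k.factorial * (((N + 1 : ℕ) : ℝ) ^ (k + 1))⁻¹ *
        lerchTheta b (k + 1) (i + 1 : ℕ) (N + 1 : ℕ))) := ⟨_, fun _ _ => rfl⟩
  have hJ : ∀ t ∈ Ioi (0 : ℝ), t ^ m * ∫ v in Ioi (0 : ℝ),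
      (polyLiKernel b (N + 1 : ℕ) v * h (t - v) +
      (-1 - polyLiKernel b (N + 1 : ℕ) v) * h (t + v)) = b * a ^ N *
      (t ^ m * (lerchKernel (a ^ (N + 1) * b) (N + 1 : ℕ) (N + 1 : ℕ) t *
      (a * (-(1 + (-1) ^ (Q + 1)) * (a * (Q.factorial * lerchPhi a (Q + 1) 1))) +
        ∑ j ∈ Finset.range ((Q + 1) / 2 + 1), D j * t ^ (Q + 1 - 2 * j) -
        ∑ i ∈ Finset.range N, Real.exp ((i + 1 : ℕ) * t) *
          ∑ k ∈ Finset.range (Q + 1), E i k * t ^ (Q - k)))) := by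
    intro t ht
    rw [integral_symm_kernel_mul_weight ha hb N hQ hval ht, mul_add a, Finset.mul_sum _ _ a]
    have hs1 : ∀ j ∈ Finset.range ((Q + 1) / 2 + 1), a * (2 * b * (Q.factorial /
        (Q + 1 - 2 * j).factorial * (((N + 1 : ℕ) : ℝ) ^ (2 * j))⁻¹ * lerchPhi b (2 * j) 1) *
        t ^ (Q + 1 - 2 * j)) = D j * t ^ (Q + 1 - 2 * j) := fun j _ => by rw [hD]; ring
    have hs2 : ∀ i ∈ Finset.range N, a ^ i * Real.exp ((i + 1 : ℕ) * t) *
        ∑ k ∈ Finset.range (Q + 1), (Q.choose k : ℝ) * t ^ (Q - k) *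
        ((-1) ^ k * k.factorial * (((N + 1 : ℕ) : ℝ) ^ (k + 1))⁻¹ *
          lerchTheta b (k + 1) (i + 1 : ℕ) (N + 1 : ℕ)) =
        Real.exp ((i + 1 : ℕ) * t) * ∑ k ∈ Finset.range (Q + 1), E i k * t ^ (Q - k) := by
      intro i _
      rw [Finset.mul_sum, Finset.mul_sum]
      exact Finset.sum_congr rfl fun k _ => by rw [hE]; ring
    rw [Finset.sum_congr rfl hs1, Finset.sum_congr rfl hs2]
    ring
  rw [integral_const_mul, hexch, setIntegral_congr_fun measurableSet_Ioi hJ, integral_const_mul,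
    integral_pow_mul_inner ha hb N m Q hm]
  have T1 : κ * (b * a ^ N * (a * (-(1 + (-1) ^ (Q + 1)) * (a * (Q.factorial *
      lerchPhi a (Q + 1) 1))) * (m.factorial * (((N + 1 : ℕ) : ℝ) ^ (m + 1))⁻¹ *
        lerchPhi (a ^ (N + 1) * b) (m + 1) 1))) =
      -(a ^ N * b * (1 + (-1) ^ (Q + 1)) * (Q.factorial : ℝ) *
          lerchPhi (a ^ (N + 1) * b) (m + 1) 1 * lerchPhi a (Q + 1) 1) := by
    have hf : (m.factorial : ℝ) ≠ 0 := by positivity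
    have : κ * (m.factorial * (((N + 1 : ℕ) : ℝ) ^ (m + 1))⁻¹) = 1 := by
      rw [hκ]; field_simp
    linear_combination (-(1 + (-1) ^ (Q + 1)) * b * a ^ N * (a * a) * Q.factorial *
      lerchPhi a (Q + 1) 1 * lerchPhi (a ^ (N + 1) * b) (m + 1) 1) * this +
      (-(1 + (-1) ^ (Q + 1)) * b * a ^ N * Q.factorial *
      lerchPhi a (Q + 1) 1 * lerchPhi (a ^ (N + 1) * b) (m + 1) 1) * haa
  have T2 : κ * (b * a ^ N * ∑ j ∈ Finset.range ((Q + 1) / 2 + 1),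
      D j * ((m + (Q + 1 - 2 * j)).factorial * (((N + 1 : ℕ) : ℝ) ^ (m + (Q + 1 - 2 * j) + 1))⁻¹ *
      lerchPhi (a ^ (N + 1) * b) (m + (Q + 1 - 2 * j) + 1) 1)) =
      2 * a ^ (N + 1) * (((N + 1 : ℕ) : ℝ) ^ (Q + 1))⁻¹ * (Q.factorial : ℝ) *
          ∑ j ∈ Finset.range ((Q + 1) / 2 + 1),
            ((m + 1 + (Q + 1) - 2 * j - 1).choose m : ℝ) *
              lerchPhi b (2 * j) 1 * lerchPhi (a ^ (N + 1) * b) (m + 1 + (Q + 1) - 2 * j) 1 := by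
    rw [← mul_assoc, Finset.mul_sum, Finset.mul_sum]
    refine Finset.sum_congr rfl fun j hj => ?_
    have hj : 2 * j ≤ Q + 1 := by have := Finset.mem_range.1 hj; omega
    have hsc := choose_factorial_scaling m (Q + 1 - 2 * j) (2 * j) hn0
    rw [Nat.sub_add_cancel hj] at hsc
    rw [show m + 1 + (Q + 1) - 2 * j - 1 = m + (Q + 1 - 2 * j) by omega,
      show m + 1 + (Q + 1) - 2 * j = m + (Q + 1 - 2 * j) + 1 by omega]
    generalize lerchPhi (a ^ (N + 1) * b) _ _ = P
    rw [hD, pow_succ a N]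
    linear_combination (2 * a ^ N * a * (b * b) * Q.factorial * lerchPhi b (2 * j) 1 * P) * hsc +
      (2 * a ^ N * a * Q.factorial * lerchPhi b (2 * j) 1 * P *
      (((m + (Q + 1 - 2 * j)).choose m : ℝ) * (((N + 1 : ℕ) : ℝ) ^ (Q + 1))⁻¹)) * hbb
  have T3 : κ * (b * a ^ N * ∑ i ∈ Finset.range N, ∑ k ∈ Finset.range (Q + 1),
      E i k * ((m + (Q - k)).factorial * (((N + 1 : ℕ) : ℝ) ^ (m + (Q - k) + 1))⁻¹ *
        lerchPhi (a ^ (N + 1) * b) (m + (Q - k) + 1)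
          (((N + 1 : ℕ) - (i + 1 : ℕ)) / (N + 1 : ℕ)))) =
      -(a ^ N * b * (((N + 1 : ℕ) : ℝ) ^ (Q + 1))⁻¹ * (Q.factorial : ℝ) *
          ∑ j ∈ Finset.Icc 2 (N + 1), ∑ k ∈ Finset.Icc 1 (Q + 1),
            ((m + 1 + (Q + 1) - k - 1).choose m : ℝ) * a ^ j * (-1) ^ k *
              lerchTheta b k ((j : ℝ) - 1) (N + 1 : ℕ) *
              lerchPhi (a ^ (N + 1) * b) (m + 1 + (Q + 1) - k)
                ((((N + 1 : ℕ) : ℝ) - j + 1) / (N + 1 : ℕ))) := by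
    rw [← Finset.Ico_add_one_right_eq_Icc 2, ← Finset.Ico_add_one_right_eq_Icc 1,
      Finset.sum_Ico_eq_sum_range, show N + 1 + 1 - 2 = N by omega, ← mul_assoc, Finset.mul_sum,
      ← neg_mul, Finset.mul_sum]
    refine Finset.sum_congr rfl fun i _ => ?_
    rw [Finset.sum_Ico_eq_sum_range, Nat.add_sub_cancel, Finset.mul_sum, Finset.mul_sum]
    refine Finset.sum_congr rfl fun k hk => ?_
    have hk : k ≤ Q := by have := Finset.mem_range.1 hk; omega
    have hsc := choose_factorial_scaling m (Q - k) (k + 1) hn0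
    rw [show Q - k + (k + 1) = Q + 1 by omega] at hsc
    have hc : (Q.choose k : ℝ) * k.factorial * (Q - k).factorial = Q.factorial := by
      exact_mod_cast Nat.choose_mul_factorial_mul_factorial hk
    have hf : ((Q - k).factorial : ℝ) ≠ 0 := by positivity
    have hc' : (Q.choose k : ℝ) * k.factorial = Q.factorial * ((Q - k).factorial : ℝ)⁻¹ := by
      rw [← hc]; field_simp
    rw [hE, show m + 1 + (Q + 1) - (1 + k) - 1 = m + (Q - k) by omega,
      show m + 1 + (Q + 1) - (1 + k) = m + (Q - k) + 1 by omega, add_comm 1 k,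
      show (((2 + i : ℕ) : ℝ) - 1) = (i + 1 : ℕ) by push_cast; ring,
      show (((N + 1 : ℕ) : ℝ) - (2 + i : ℕ) + 1) = (N + 1 : ℕ) - (i + 1 : ℕ) by push_cast; ring,
      pow_add a 2 i, show a ^ 2 = 1 by rw [sq, haa], pow_succ (-1 : ℝ) k]
    generalize lerchPhi (a ^ (N + 1) * b) _ _ = P
    generalize lerchTheta b _ _ _ = Θ
    linear_combination (b * a ^ N * a ^ i * (-1) ^ k * Θ * P * κ * ((m + (Q - k)).factorial *
      (((N + 1 : ℕ) : ℝ) ^ (m + (Q - k) + 1))⁻¹) * (((N + 1 : ℕ) : ℝ) ^ (k + 1))⁻¹) * hc' +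
      (b * a ^ N * a ^ i * (-1) ^ k * Θ * P * Q.factorial) * hsc
  rw [← T1, ← T2, mul_sub, mul_sub, mul_add, mul_add, T3]
  ring
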